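/- Setting. Let $(X,d)$ be a metric space in which every closed ball is compact, let $X_0\subseteq X$ be open and dense, and let $T:X_0\to X$ be continuous. $T^n$ is defined on $T^{-n}(X)=\{x: x,Tx,\dots,T^{n-1}x\in X_0\}$. For an open set $U\subseteq X$ and $n\ge 1$, a decomposition of $T^{-n}(U)$ into (injective) components is a family of pairwise disjoint open sets with union $T^{-n}(U)$, each of which $T^n$ maps homeomorphically onto $U$. Write $D_df(x)=\lim_{y\to x,\,y\ne x} d(f(y),f(x))/d(y,x)$ for the metric derivative ("exists at $x$" includes that $x$ is not isolated). $T$ is weak Walters expanding with constants $C(a)\ge 1$ ($a\in X$) if: (a) $T^{-1}(x)$ is at most countable for every $x\in X$; (b) for each $x\in X$ there is $\delta_x>0$ such that for each $n\ge 1$ the set $T^{-n}(B(x,\delta_x))$ is decomposed into components (fixed from now on); (c) for all $\varepsilon>0$ and $x\in X$ there is $0<\delta_0<\delta_x$ such that if $y,y'$ lie in one component of $T^{-1}(B(x,\delta_x))$, $T(y)=x$ and $d(x,T(y'))<\delta_0$, then $d(y,y')<\varepsilon$; (d) for each $a\in X$ there are $\varrho>0$ and $N\ge1$ such that $d(T^{nN}y,T^{nN}y')\ge\varrho\,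 C(a)^n d(y,y')$ for all $n\ge1$ and all $y,y'$ in one component of $T^{-nN}(B(a,\delta_a))$; (e) for all $x\in X_0$, $r>0$ and compact $K\subseteq X$ there is $M\ge 1$ with $K\subseteq T^M(B(x,r)\cap T^{-M}(X))$. $T$ is conformal if $D_dT$ exists at every point of $X_0$, and for each $x\in X$ there is $M(x)$ such that for every $n\ge1$ and every component $A$ of $T^{-n}(B(x,\delta_x))$: $D_dT^n(y)\le M(x)D_dT^n(y')$ for all $y,y'\in A$, and for all $y,y'\in A$ there is $w\in A$ with $d(T^ny,T^ny')\le D_dT^n(w)\,d(y,y')$. For $t\ge0$, $n\ge1$, $a\in X$ let $\mathcal L^n_t(a)=\sum_{T^n(z)=a}D_dT^n(z)^{-t}\in[0,\infty]$. The pressure $P(T,t)\in[-\infty,\infty]$ is the common value, for all $a\in X$, of $\limsup_{n}\frac1n\log\mathcal L_t^n(a)$ and $\liminf_{n}\frac1n\log\mathcal L_t^n(a)$, if there is one, and $s(T)=\inf\{t\ge0:P(T,t)\le0\}$, with $s(T)=\infty$ if there is no such $t$. Corollary. Let $T:X_0\to X$ be a weak Walters expanding conformal map with $C(a)>1$ for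 every $a\in X$. Assume that there are a point $x\in X$, numbers $R>0$, $K$, $R_1$ and a function $\phi:(0,\infty)\to(0,\infty)$ with $\phi(r)\ge r$ for $r\ge R_1$ such that for any two points $a,b\in X\setminus B(x,R)$ and each $n\ge1$ there is an open set $U\ni a,b$ such that $T^{-n}(U)$ has a decomposition into components on each of which the single valued branch $g:U\to T^{-n}(U)$ of $T^{-n}$ satisfies: the distortion of $g$ over $a$ and $b$ is bounded by $K$, i.e. $D_dT^n(g(a))\le K\,D_dT^n(g(b))$ and $D_dT^n(g(b))\le K\,D_dT^n(g(a))$; and for all $r\ge R_1$, if $g(a)\in B(x,r)$ then $g(b)\in B(x,\phi(r))$. Assume also $\dim_H(X)<\infty$. Then $P(T,t)$ exists for every $t\ge0$, and (1) $s(T)\le\dim_H(X)<\infty$; (2) for every $a\in X$, as $n\to\infty$, $\mathcal L^n_t(a)\to\infty$ if $0\le t<s(T)$, and $\mathcal L^n_t(a)\to0$ if $t>s(T)$. -/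

import Mathlib

open Set Filter Topology Metric
open scoped NNReal ENNReal

/-! A map `T : X₀ → X` defined on a subset `X₀` of `X` is represented by a total function
`T : X → X`; everything below only looks at the values of `T` on `X₀`. -/

/-- The domain `T⁻ⁿ(X)` of the `n`-th iterate of the partial map `T : X₀ → X`. -/
def iterDomain {X : Type*} (T : X → X) (X₀ : Set X) (n : ℕ) : Set X :=
  {x | ∀ k < n, T^[k] x ∈ X₀}

/-- The preimage `T⁻ⁿ(U)` under the `n`-th iterate of the partial map `T : X₀ → X`. -/
def iterPreimage {X : Type*} (T : X → X) (X₀ : Set X) (n : ℕ) (U : Set X) : Set X :=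
  {x | x ∈ iterDomain T X₀ n ∧ T^[n] x ∈ U}

/-- The metric derivative `D_d f(x) = lim_{y → x} d(f(y), f(x)) / d(y, x)` exists and is `L`.
The limit is over `y ≠ x`, so `x` has to be an accumulation point. -/
def HasMetricDerivAt {X : Type*} [MetricSpace X] (f : X → X) (L : ℝ) (x : X) : Prop :=
  (𝓝[≠] x).NeBot ∧ Tendsto (fun y => dist (f y) (f x) / dist y x) (𝓝[≠] x) (𝓝 L)

/-- The value `D_d f(x)` of the metric derivative (meaningful where it exists). -/
noncomputable def metricDeriv {X : Type*} [MetricSpace X] (f : X → X) (x : X) : ℝ :=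
  limUnder (𝓝[≠] x) (fun y => dist (f y) (f x) / dist y x)

theorem HasMetricDerivAt.metricDeriv_eq {X : Type*} [MetricSpace X] {f : X → X} {L : ℝ} {x : X}
    (h : HasMetricDerivAt f L x) : metricDeriv f x = L := by
  have := h.1
  exact h.2.limUnder_eq

/-- `𝒜` is a decomposition of `T⁻ⁿ(U)` into injective components: pairwise disjoint open sets with
union `T⁻ⁿ(U)`, each of which `Tⁿ` maps homeomorphically onto `U`. -/
structure IsInjectiveComponents {X : Type*} [MetricSpace X] (T : X → X) (X₀ : Set X)
    (n : ℕ) (U : Set X) (𝒜 : Set (Set X)) : Prop where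
  isOpen : ∀ A ∈ 𝒜, IsOpen A
  disjoint : 𝒜.PairwiseDisjoint id
  sUnion_eq : ⋃₀ 𝒜 = iterPreimage T X₀ n U
  homeo : ∀ A ∈ 𝒜, ∃ e : A ≃ₜ U, ∀ y : A, (e y : X) = T^[n] (y : X)

/-- `T : X₀ → X` is weak Walters expanding, with radii `δ x`, with `𝒜 x n` the set of components of
`T⁻ⁿ(B(x, δ x))`, and with expanding constant `C a` at `a`. -/
structure IsWeakWaltersExpanding {X : Type*} [MetricSpace X] (T : X → X) (X₀ : Set X)
    (δ : X → ℝ) (𝒜 : X → ℕ → Set (Set X)) (C : X → ℝ) : Prop where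
  countable : ∀ x, (iterPreimage T X₀ 1 {x}).Countable
  δ_pos : ∀ x, 0 < δ x
  components : ∀ x n, 1 ≤ n → IsInjectiveComponents T X₀ n (ball x (δ x)) (𝒜 x n)
  inverse_equicontinuous : ∀ ε > 0, ∀ x, ∃ δ₀, 0 < δ₀ ∧ δ₀ < δ x ∧
    ∀ A ∈ 𝒜 x 1, ∀ y ∈ A, ∀ y' ∈ A, T y = x → dist x (T y') < δ₀ → dist y y' < ε
  one_le : ∀ a, 1 ≤ C a
  expanding : ∀ a, ∃ ϱ > (0 : ℝ), ∃ N : ℕ, 1 ≤ N ∧ ∀ n, 1 ≤ n →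
    ∀ A ∈ 𝒜 a (n * N), ∀ y ∈ A, ∀ y' ∈ A,
      ϱ * C a ^ n * dist y y' ≤ dist (T^[n * N] y) (T^[n * N] y')
  covering : ∀ x ∈ X₀, ∀ r > 0, ∀ K : Set X, IsCompact K →
    ∃ M : ℕ, 1 ≤ M ∧ K ⊆ T^[M] '' (ball x r ∩ iterDomain T X₀ M)

/-- `T : X₀ → X` is conformal (with respect to the components `𝒜 x n` of `T⁻ⁿ(B(x, δ x))`): it has a
metric derivative at each point of `X₀`, the iterates `Tⁿ` have bounded distortion on the components
with a constant that depends only on `x`, and they satisfy a mean value inequality there. -/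
structure IsMetricConformal {X : Type*} [MetricSpace X] (T : X → X) (X₀ : Set X)
    (𝒜 : X → ℕ → Set (Set X)) : Prop where
  hasDeriv : ∀ x ∈ X₀, ∃ L, HasMetricDerivAt T L x
  distortion : ∀ x, ∃ M : ℝ, ∀ n, 1 ≤ n → ∀ A ∈ 𝒜 x n, ∀ y ∈ A, ∀ y' ∈ A,
    metricDeriv T^[n] y ≤ M * metricDeriv T^[n] y'
  mean_value : ∀ x n, 1 ≤ n → ∀ A ∈ 𝒜 x n, ∀ y ∈ A, ∀ y' ∈ A,
    ∃ w ∈ A, dist (T^[n] y) (T^[n] y') ≤ metricDeriv T^[n] w * dist y y'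

/-- There are a point `x` and an `R > 0` such that for any two points `a`, `b` outside `B(x, R)` and
each `n`, the single valued branches `g` of `T⁻ⁿ` are defined on a common open set `U` containing
`a` and `b`, have bounded distortion over `a` and `b` (with a constant `K`), and satisfy
`g a ∈ B(x, r) → g b ∈ B(x, φ r)` for all sufficiently large `r`, where `φ` is a positive function
with `φ r ≥ r` for large `r`. The branch `g` is the inverse of `Tⁿ` on the component `A`; it takes
the value `y` at `a` and `z` at `b`, and its derivatives there are the inverses of the derivatives
of `Tⁿ` at `y` and `z`. -/
def HasComparableBranches {X : Type*} [MetricSpace X] (T : X → X) (X₀ : Set X) : Prop :=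
  ∃ (x : X) (R K R₁ : ℝ) (φ : ℝ → ℝ), 0 < R ∧ (∀ r > 0, 0 < φ r) ∧ (∀ r ≥ R₁, r ≤ φ r) ∧
    ∀ a ∉ ball x R, ∀ b ∉ ball x R, ∀ n, 1 ≤ n →
      ∃ (U : Set X) (𝒢 : Set (Set X)), IsOpen U ∧ a ∈ U ∧ b ∈ U ∧
        IsInjectiveComponents T X₀ n U 𝒢 ∧
        ∀ A ∈ 𝒢, ∀ y ∈ A, ∀ z ∈ A, T^[n] y = a → T^[n] z = b →
          metricDeriv T^[n] y ≤ K * metricDeriv T^[n] z ∧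
          metricDeriv T^[n] z ≤ K * metricDeriv T^[n] y ∧
          ∀ r ≥ R₁, y ∈ ball x r → z ∈ ball x (φ r)

/-- The Poincaré sum `∑_{Tⁿ(z) = a} D_d Tⁿ(z)^{-t}`. -/
noncomputable def poincareSum {X : Type*} [MetricSpace X] (T : X → X) (X₀ : Set X)
    (t : ℝ) (n : ℕ) (a : X) : ℝ≥0∞ :=
  ∑' z : iterPreimage T X₀ n {a}, ENNReal.ofReal (metricDeriv T^[n] (z : X)) ^ (-t)

/-- The upper pressure at the point `a`. -/
noncomputable def upperPressureAt {X : Type*} [MetricSpace X] (T : X → X) (X₀ : Set X)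
    (t : ℝ) (a : X) : EReal :=
  limsup (fun n : ℕ => ENNReal.log (poincareSum T X₀ t n a) / (n : EReal)) atTop

/-- The lower pressure at the point `a`. -/
noncomputable def lowerPressureAt {X : Type*} [MetricSpace X] (T : X → X) (X₀ : Set X)
    (t : ℝ) (a : X) : EReal :=
  liminf (fun n : ℕ => ENNReal.log (poincareSum T X₀ t n a) / (n : EReal)) atTop

/-- The pressure `P(T, t)` exists and equals `p`: at every point the upper and the lower pressure
are both equal to `p`. -/
def HasPressure {X : Type*} [MetricSpace X] (T : X → X) (X₀ : Set X) (t : ℝ) (p : EReal) : Prop :=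
  ∀ a, upperPressureAt T X₀ t a = p ∧ lowerPressureAt T X₀ t a = p

/-- The Poincaré exponent `s(T) = inf {t ≥ 0 : P(T, t) ≤ 0}`, equal to `∞` if there is no such
`t`. -/
noncomputable def poincareExponent {X : Type*} [MetricSpace X] (T : X → X) (X₀ : Set X) : ℝ≥0∞ :=
  ⨅ t ∈ {t : ℝ≥0 | ∃ p : EReal, HasPressure T X₀ (t : ℝ) p ∧ p ≤ 0}, (t : ℝ≥0∞)

/-!
Write `L n a` for the Poincaré sum of order `n` at `a`. By the chain rule, grouping the points of
`T^{-(m+n)}(a)` by their image under `Tⁿ` gives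
`L (m + n) a = ∑_{T^m(w) = a} D_d T^m(w)^{-t} L n w` (`IsDerivCocycle.branchSum_add`), so the
suprema `U n = sup L n` are submultiplicative and the infima `u n = inf L n` supermultiplicative. Inverse
branches over a common set `U` allow a comparison of `L n` at two points of `U`
(`IsDerivCocycle.branchSum_le_of_components`). A closed ball around the base point of the branch
condition is covered by finitely many sets `B(e, δ e)`, and the branch condition compares any two
points outside, so finitely many points represent all of `X` up to a constant. Together with the
covering property this gives `c * U n ≤ u (n + M)` (`IsDerivCocycle.exists_mixing`), and Fekete's
lemma for `log U n` yields the pressure.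

Since the derivatives along `T^{nN}` grow exponentially over each point, the pressure is negative
beyond any exponent at which it is nonpositive (`IsDerivCocycle.pressure_neg`). Hence it is positive
below `s(T)` and negative above, which determines the limits of `L n a`.

For `s(T) ≤ dim_H X` it suffices that positive pressure at `t > 0` makes the `t`-dimensional
Hausdorff measure of `X` positive. If the pressure is positive, some fixed `n` has large sums `L n b`
at all `b`. The function `φ` of the branch condition and compactness show that the points of one
ball `Y` already provide these (`IsDerivCocycle.exists_ball_le_branchSum`). Composing such branches,
and returning from `Y` to a point `a` by the covering property, gives arbitrarily large sums
over branches that end close to `a`. By expansion these branches map a compact ball `K` around `a`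
into itself, finitely many of them carry the sum, and the mean value inequality and
bounded distortion bound the Lipschitz constant of `T^m` on the image of each. This is a disjoint
self-similar subdivision inside `K` with `∑ (Lipschitz constant)^{-t} ≥ 1`. An induction on the
number of sets shows that the `t`-sum of any finite cover of `K` is bounded below
(`rpow_le_sum_ediam_rpow`), without the need for a limit set or a measure on it.
-/

/-! ### Metric derivatives of the iterates and injective components -/

theorem mem_iterDomain_add {X : Type*} {T : X → X} {X₀ : Set X} {m n : ℕ}
    {z : X} :
    z ∈ iterDomain T X₀ (m + n) ↔ z ∈ iterDomain T X₀ n ∧ T^[n] z ∈ iterDomain T X₀ m := by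
  constructor
  · intro h
    refine ⟨fun k hk => h k (by omega), fun k hk => ?_⟩
    rw [← Function.iterate_add_apply]
    exact h _ (by omega)
  · rintro ⟨h₁, h₂⟩ k hk
    rcases lt_or_ge k n with hkn | hkn
    · exact h₁ k hkn
    · have := h₂ (k - n) (by omega)
      rwa [← Function.iterate_add_apply, Nat.sub_add_cancel hkn] at this

theorem mem_iterDomain_one {X : Type*} {T : X → X} {X₀ : Set X} {z : X} :
    z ∈ iterDomain T X₀ 1 ↔ z ∈ X₀ := by
  constructor
  · intro h
    exact h 0 one_pos
  · intro h k hk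
    obtain rfl : k = 0 := by omega
    exact h

section Derivative

variable {X : Type*} [MetricSpace X] {T : X → X} {X₀ : Set X} {δ C : X → ℝ}
  {𝒜 : X → ℕ → Set (Set X)}

theorem HasMetricDerivAt.nonneg {f : X → X} {L : ℝ} {x : X} (h : HasMetricDerivAt f L x) :
    0 ≤ L := by
  have := h.1
  exact ge_of_tendsto' h.2 fun y => by positivity

theorem HasMetricDerivAt.comp {f g : X → X} {L L' : ℝ} {x : X} (hL : 0 < L)
    (hf : HasMetricDerivAt f L x) (hg : HasMetricDerivAt g L' (f x)) :
    HasMetricDerivAt (g ∘ f) (L * L') x := by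
  refine ⟨hf.1, ?_⟩
  -- A positive derivative keeps `f y` away from `f x`, so `f y` is an admissible argument of the
  -- difference quotient of `g`.
  have hne : ∀ᶠ y in 𝓝[≠] x, f y ≠ f x := by
    filter_upwards [hf.2.eventually (lt_mem_nhds hL)] with y hy hxy
    simp [hxy] at hy
  have hdist : Tendsto (fun y => dist y x) (𝓝[≠] x) (𝓝 0) := by
    have : Tendsto (fun y => dist y x) (𝓝 x) (𝓝 (dist x x)) :=
      (continuous_id.dist continuous_const).tendsto x
    rw [dist_self] at this
    exact this.mono_left nhdsWithin_le_nhds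
  have hcont : Tendsto f (𝓝[≠] x) (𝓝 (f x)) := by
    rw [tendsto_iff_dist_tendsto_zero]
    have h := hf.2.mul hdist
    rw [mul_zero] at h
    refine h.congr' ?_
    filter_upwards [self_mem_nhdsWithin] with y hy
    exact div_mul_cancel₀ _ (dist_ne_zero.2 hy)
  have hlim : Tendsto f (𝓝[≠] x) (𝓝[≠] (f x)) :=
    tendsto_nhdsWithin_iff.2 ⟨hcont, hne⟩
  refine (hf.2.mul (hg.2.comp hlim)).congr' ?_
  filter_upwards [hne] with y hy
  have := dist_ne_zero.2 hy
  simp only [Function.comp_apply]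
  field_simp

/-- The iterates of `T` have positive metric derivatives that satisfy the chain rule, and `X` has no
isolated points, so that the identity has metric derivative `1` everywhere. -/
structure IsDerivCocycle (T : X → X) (X₀ : Set X) : Prop where
  pos : ∀ n, ∀ z ∈ iterDomain T X₀ n, 0 < metricDeriv T^[n] z
  chain : ∀ m n, ∀ z ∈ iterDomain T X₀ (m + n),
    metricDeriv T^[m + n] z = metricDeriv T^[n] z * metricDeriv T^[m] (T^[n] z)
  zero : ∀ z, metricDeriv T^[0] z = 1
  neBot : ∀ x : X, (𝓝[≠] x).NeBot
  hasDeriv : ∀ n, ∀ z ∈ iterDomain T X₀ n, HasMetricDerivAt T^[n] (metricDeriv T^[n] z) z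

theorem IsInjectiveComponents.injOn {n : ℕ} {U : Set X} {𝒢 : Set (Set X)}
    (h : IsInjectiveComponents T X₀ n U 𝒢) {A : Set X} (hA : A ∈ 𝒢) : InjOn T^[n] A := by
  obtain ⟨e, he⟩ := h.homeo A hA
  intro y hy z hz hyz
  have : e ⟨y, hy⟩ = e ⟨z, hz⟩ := Subtype.ext (by rw [he, he]; exact hyz)
  simpa using e.injective this

theorem IsInjectiveComponents.surjOn {n : ℕ} {U : Set X} {𝒢 : Set (Set X)}
    (h : IsInjectiveComponents T X₀ n U 𝒢) {A : Set X} (hA : A ∈ 𝒢) {b : X} (hb : b ∈ U) :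
    ∃ z ∈ A, T^[n] z = b := by
  obtain ⟨e, he⟩ := h.homeo A hA
  exact ⟨e.symm ⟨b, hb⟩, (e.symm ⟨b, hb⟩).2, by rw [← he]; simp⟩

theorem IsInjectiveComponents.subset {n : ℕ} {U : Set X} {𝒢 : Set (Set X)}
    (h : IsInjectiveComponents T X₀ n U 𝒢) {A : Set X} (hA : A ∈ 𝒢) :
    A ⊆ iterPreimage T X₀ n U := by
  rw [← h.sUnion_eq]
  exact subset_sUnion_of_mem hA

theorem IsInjectiveComponents.exists_mem {n : ℕ} {U : Set X} {𝒢 : Set (Set X)}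
    (h : IsInjectiveComponents T X₀ n U 𝒢) {a z : X} (ha : a ∈ U)
    (hz : z ∈ iterPreimage T X₀ n {a}) : ∃ A ∈ 𝒢, z ∈ A := by
  have : z ∈ ⋃₀ 𝒢 := by
    rw [h.sUnion_eq]
    exact ⟨hz.1, by rw [show T^[n] z = a from hz.2]; exact ha⟩
  exact this

theorem IsInjectiveComponents.isOpen_image {n : ℕ} {U : Set X} {𝒢 : Set (Set X)}
    (h : IsInjectiveComponents T X₀ n U 𝒢) (hU : IsOpen U) {A : Set X} (hA : A ∈ 𝒢)
    {V : Set X} (hV : IsOpen V) : IsOpen (T^[n] '' (A ∩ V)) := by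
  obtain ⟨e, he⟩ := h.homeo A hA
  have himage : T^[n] '' (A ∩ V) = Subtype.val '' (e '' (Subtype.val ⁻¹' V)) := by
    ext b
    constructor
    · rintro ⟨y, ⟨hy, hyV⟩, rfl⟩
      exact ⟨e ⟨y, hy⟩, ⟨⟨y, hy⟩, hyV, rfl⟩, he _⟩
    · rintro ⟨_, ⟨y, hyV, rfl⟩, rfl⟩
      exact ⟨y, ⟨y.2, hyV⟩, (he y).symm⟩
  rw [himage]
  exact hU.isOpenMap_subtype_val _ (e.isOpenMap _ (hV.preimage continuous_subtype_val))

/-- If the derivative vanished at `y`, bounded distortion and the mean value inequality would make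
`T` constant on a component around `y`, although `T` is injective there and `y` is not isolated. -/
theorem metricDeriv_pos (hW : IsWeakWaltersExpanding T X₀ δ 𝒜 C)
    (hconf : IsMetricConformal T X₀ 𝒜) {y : X} (hy : y ∈ X₀) : 0 < metricDeriv T y := by
  obtain ⟨L, hL⟩ := hconf.hasDeriv y hy
  have hnonneg : 0 ≤ metricDeriv T y := by rw [hL.metricDeriv_eq]; exact hL.nonneg
  refine hnonneg.lt_of_ne fun h0 => ?_
  have hcomp := hW.components (T y) 1 le_rfl
  obtain ⟨A, hA, hyA⟩ := hcomp.exists_mem (mem_ball_self (hW.δ_pos (T y)))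
    (show y ∈ iterPreimage T X₀ 1 {T y} from ⟨mem_iterDomain_one.2 hy, rfl⟩)
  obtain ⟨M, hM⟩ := hconf.distortion (T y)
  have hev : ∀ᶠ y' in 𝓝[≠] y, y' ∈ A :=
    mem_nhdsWithin_of_mem_nhds ((hcomp.isOpen A hA).mem_nhds hyA)
  have := hL.1
  obtain ⟨y', hy'A, hy'⟩ := (hev.and self_mem_nhdsWithin).exists
  obtain ⟨w, hwA, hw⟩ := hconf.mean_value (T y) 1 le_rfl A hA y hyA y' hy'A
  have hDw : metricDeriv T^[1] w ≤ 0 := by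
    have := hM 1 le_rfl A hA w hwA y hyA
    rwa [Function.iterate_one, ← h0, mul_zero] at this
  have hle : dist (T^[1] y) (T^[1] y') ≤ 0 :=
    hw.trans (mul_nonpos_of_nonpos_of_nonneg hDw dist_nonneg)
  exact hy' (hcomp.injOn hA hyA hy'A (dist_le_zero.1 hle)).symm

theorem isDerivCocycle (hX₀ : Dense X₀) (hW : IsWeakWaltersExpanding T X₀ δ 𝒜 C)
    (hconf : IsMetricConformal T X₀ 𝒜) : IsDerivCocycle T X₀ := by
  -- An isolated point would belong to the dense set `X₀`, where the derivative exists.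
  have hneBot : ∀ x : X, (𝓝[≠] x).NeBot := by
    intro x
    by_contra hx
    have hopen : IsOpen ({x} : Set X) := by
      rw [not_neBot] at hx
      exact (isOpen_singleton_iff_punctured_nhds x).2 hx
    obtain ⟨y, hy, hyX⟩ := hX₀.exists_mem_open hopen ⟨x, rfl⟩
    obtain rfl : y = x := hyX
    exact hx (hconf.hasDeriv y hy).choose_spec.1
  have hzero : ∀ z : X, HasMetricDerivAt T^[0] 1 z := by
    intro z
    refine ⟨hneBot z, tendsto_const_nhds.congr' ?_⟩
    filter_upwards [self_mem_nhdsWithin] with y hy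
    exact (div_self (dist_ne_zero.2 hy)).symm
  have hone : ∀ z ∈ X₀, HasMetricDerivAt T (metricDeriv T z) z := by
    intro z hz
    obtain ⟨L, hL⟩ := hconf.hasDeriv z hz
    rwa [hL.metricDeriv_eq]
  have hall : ∀ n, ∀ z ∈ iterDomain T X₀ n,
      HasMetricDerivAt T^[n] (metricDeriv T^[n] z) z ∧ 0 < metricDeriv T^[n] z := by
    intro n
    induction n with
    | zero =>
      intro z _
      rw [(hzero z).metricDeriv_eq]
      exact ⟨hzero z, one_pos⟩
    | succ n ih =>
      intro z hz
      rw [add_comm n 1, mem_iterDomain_add, mem_iterDomain_one] at hz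
      have hcomp := (ih z hz.1).1.comp (ih z hz.1).2 (hone _ hz.2)
      rw [← Function.iterate_succ'] at hcomp
      rw [hcomp.metricDeriv_eq]
      exact ⟨hcomp, mul_pos (ih z hz.1).2 (metricDeriv_pos hW hconf hz.2)⟩
  refine ⟨fun n z hz => (hall n z hz).2, fun m n z hz => ?_, fun z => (hzero z).metricDeriv_eq,
    hneBot, fun n z hz => (hall n z hz).1⟩
  rw [mem_iterDomain_add] at hz
  have hcomp := (hall n z hz.1).1.comp (hall n z hz.1).2 (hall m _ hz.2).1
  rw [← Function.iterate_add] at hcomp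
  exact hcomp.metricDeriv_eq

theorem IsDerivCocycle.le_metricDeriv (hD : IsDerivCocycle T X₀) {n : ℕ} {U : Set X}
    {𝒢 : Set (Set X)} (h : IsInjectiveComponents T X₀ n U 𝒢) {A : Set X} (hA : A ∈ 𝒢) {c : ℝ}
    (hc : ∀ y ∈ A, ∀ y' ∈ A, c * dist y y' ≤ dist (T^[n] y) (T^[n] y')) {y : X} (hy : y ∈ A) :
    c ≤ metricDeriv T^[n] y := by
  have hderiv := hD.hasDeriv n y (h.subset hA hy).1
  have := hD.neBot y
  refine ge_of_tendsto hderiv.2 ?_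
  filter_upwards [mem_nhdsWithin_of_mem_nhds ((h.isOpen A hA).mem_nhds hy),
    self_mem_nhdsWithin] with y' hy'A hy'
  rw [le_div_iff₀ (dist_pos.2 hy')]
  exact hc y' hy'A y hy

/-- `T` maps `X₀` onto `X`: by the covering property, each point has a preimage under some iterate,
hence a preimage under `T`. -/
theorem exists_preimage (hX₀ : Dense X₀) (hW : IsWeakWaltersExpanding T X₀ δ 𝒜 C) (a : X) :
    ∃ z ∈ X₀, T z = a := by
  have : Nonempty X := ⟨a⟩
  obtain ⟨x, hx⟩ := hX₀.nonempty
  obtain ⟨M, hM, hK⟩ := hW.covering x hx 1 one_pos {a} isCompact_singleton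
  obtain ⟨z, ⟨-, hz⟩, hza⟩ := hK rfl
  refine ⟨T^[M - 1] z, hz _ (by omega), ?_⟩
  rw [← Function.iterate_succ_apply' T, Nat.succ_eq_add_one, Nat.sub_add_cancel hM, hza]

end Derivative

/-! ### Branch sums -/

/-- The weight `D_d Tⁿ(z)^{-t}` of a point `z` in a Poincaré sum. -/
noncomputable def branchWeight {X : Type*} [MetricSpace X] (T : X → X) (t : ℝ) (n : ℕ) (z : X) :
    ℝ≥0∞ :=
  ENNReal.ofReal (metricDeriv T^[n] z) ^ (-t)

/-- The part of the Poincaré sum `∑_{Tⁿ(z) = a} D_d Tⁿ(z)^{-t}` that comes from the points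
`z ∈ V`. -/
noncomputable def branchSum {X : Type*} [MetricSpace X] (T : X → X) (X₀ : Set X) (t : ℝ) (n : ℕ)
    (V : Set X) (a : X) : ℝ≥0∞ :=
  ∑' z : ↥(iterPreimage T X₀ n {a} ∩ V), branchWeight T t n z

section BranchSum

variable {X : Type*} [MetricSpace X] {T : X → X} {X₀ : Set X} {t : ℝ} {m n : ℕ}

theorem poincareSum_eq_branchSum (a : X) :
    poincareSum T X₀ t n a = branchSum T X₀ t n univ a := by
  rw [branchSum, inter_univ]
  rfl

theorem branchSum_mono {V W : Set X} (h : V ⊆ W) (a : X) :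
    branchSum T X₀ t n V a ≤ branchSum T X₀ t n W a :=
  ENNReal.tsum_mono_subtype _ (inter_subset_inter_right _ h)

theorem IsDerivCocycle.branchWeight_pos (hD : IsDerivCocycle T X₀) {z : X}
    (hz : z ∈ iterDomain T X₀ n) : 0 < branchWeight T t n z :=
  ENNReal.rpow_pos (ENNReal.ofReal_pos.2 (hD.pos n z hz)) ENNReal.ofReal_ne_top

theorem IsDerivCocycle.branchWeight_add (hD : IsDerivCocycle T X₀) {z : X}
    (hz : z ∈ iterDomain T X₀ (m + n)) :
    branchWeight T t (m + n) z = branchWeight T t m (T^[n] z) * branchWeight T t n z := by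
  have hz' := mem_iterDomain_add.1 hz
  rw [branchWeight, hD.chain m n z hz, ENNReal.ofReal_mul (hD.pos n z hz'.1).le,
    ENNReal.mul_rpow_of_ne_top ENNReal.ofReal_ne_top ENNReal.ofReal_ne_top, mul_comm]
  rfl

theorem IsDerivCocycle.branchWeight_le (hD : IsDerivCocycle T X₀) (ht : 0 ≤ t) {Q : ℝ} {y z : X}
    (hy : y ∈ iterDomain T X₀ n) (hz : z ∈ iterDomain T X₀ n)
    (h : metricDeriv T^[n] z ≤ Q * metricDeriv T^[n] y) :
    branchWeight T t n y ≤ ENNReal.ofReal Q ^ t * branchWeight T t n z := by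
  have hle : ENNReal.ofReal (metricDeriv T^[n] z) ^ t ≤
      ENNReal.ofReal Q ^ t * ENNReal.ofReal (metricDeriv T^[n] y) ^ t := by
    rw [← ENNReal.mul_rpow_of_nonneg _ _ ht, ← ENNReal.ofReal_mul' (hD.pos n y hy).le]
    exact ENNReal.rpow_le_rpow (ENNReal.ofReal_le_ofReal h) ht
  have hne : ∀ w ∈ iterDomain T X₀ n, ENNReal.ofReal (metricDeriv T^[n] w) ^ t ≠ 0 ∧
      ENNReal.ofReal (metricDeriv T^[n] w) ^ t ≠ ⊤ := fun w hw =>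
    ⟨(ENNReal.rpow_pos (ENNReal.ofReal_pos.2 (hD.pos n w hw)) ENNReal.ofReal_ne_top).ne',
      ENNReal.rpow_ne_top_of_nonneg ht ENNReal.ofReal_ne_top⟩
  rw [branchWeight, branchWeight, ENNReal.rpow_neg, ENNReal.rpow_neg, ← div_eq_mul_inv,
    ENNReal.le_div_iff_mul_le (Or.inl (hne z hz).1) (Or.inl (hne z hz).2), mul_comm,
    ← div_eq_mul_inv, ENNReal.div_le_iff (hne y hy).1 (hne y hy).2]
  exact hle

theorem IsDerivCocycle.branchSum_zero (hD : IsDerivCocycle T X₀) (a : X) :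
    branchSum T X₀ t 0 univ a = 1 := by
  have hset : iterPreimage T X₀ 0 {a} ∩ univ = {a} := by
    ext z
    simp [iterPreimage, iterDomain]
  rw [branchSum, hset, tsum_singleton a (branchWeight T t 0), branchWeight, hD.zero]
  simp

/-- The points of `T^{-(m+n)}(a)` are grouped by their image `w` under `Tⁿ`. -/
theorem IsDerivCocycle.branchSum_add (hD : IsDerivCocycle T X₀) (V : Set X) (a : X) :
    branchSum T X₀ t (m + n) V a =
      ∑' w : iterPreimage T X₀ m {a}, branchWeight T t m w * branchSum T X₀ t n V w := by
  have hmem : ∀ z ∈ iterPreimage T X₀ (m + n) {a} ∩ V, z ∈ iterDomain T X₀ n ∧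
      T^[n] z ∈ iterPreimage T X₀ m {a} := by
    rintro z ⟨⟨hz, hza⟩, -⟩
    rw [Function.iterate_add_apply] at hza
    exact ⟨(mem_iterDomain_add.1 hz).1, (mem_iterDomain_add.1 hz).2, hza⟩
  let e : (Σ w : iterPreimage T X₀ m {a}, ↥(iterPreimage T X₀ n {(w : X)} ∩ V)) ≃
      ↥(iterPreimage T X₀ (m + n) {a} ∩ V) :=
    { toFun := fun p => ⟨p.2, by
        obtain ⟨⟨w, hw, hwa⟩, ⟨z, ⟨hz, hzw⟩, hzV⟩⟩ := p
        obtain rfl : T^[n] z = w := hzw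
        exact ⟨⟨mem_iterDomain_add.2 ⟨hz, hw⟩, by
          rw [Function.iterate_add_apply]; exact hwa⟩, hzV⟩⟩
      invFun := fun z => ⟨⟨T^[n] z, (hmem z z.2).2⟩, ⟨z, ⟨(hmem z z.2).1, rfl⟩, z.2.2⟩⟩
      left_inv := by
        rintro ⟨⟨w, hw, hwa⟩, ⟨z, ⟨hz, hzw⟩, hzV⟩⟩
        obtain rfl : T^[n] z = w := hzw
        rfl
      right_inv := fun z => rfl }
  rw [branchSum, ← e.tsum_eq, ENNReal.tsum_sigma']
  refine tsum_congr fun w => ?_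
  rw [branchSum, ← ENNReal.tsum_mul_left]
  refine tsum_congr fun z => ?_
  have h₁ : ((e ⟨w, z⟩ : ↥(iterPreimage T X₀ (m + n) {a} ∩ V)) : X) = z := rfl
  have h₂ : T^[n] (z : X) = w := z.2.1.2
  rw [hD.branchWeight_add (e ⟨w, z⟩).2.1.1, h₁, h₂]

theorem IsDerivCocycle.mul_branchSum_le_branchSum_add (hD : IsDerivCocycle T X₀) {V Y : Set X}
    {c : ℝ≥0∞} (hc : ∀ w ∈ Y, c ≤ branchSum T X₀ t n V w) (a : X) :
    c * branchSum T X₀ t m Y a ≤ branchSum T X₀ t (m + n) V a := by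
  rw [hD.branchSum_add, branchSum, ← ENNReal.tsum_mul_left]
  refine le_trans ?_ (ENNReal.tsum_mono_subtype
    (fun w => branchWeight T t m w * branchSum T X₀ t n V w)
    (inter_subset_left : iterPreimage T X₀ m {a} ∩ Y ⊆ _))
  refine ENNReal.tsum_le_tsum fun w => ?_
  rw [mul_comm]
  exact mul_le_mul_right (hc w w.2.2) _

theorem IsDerivCocycle.branchSum_add_le_mul (hD : IsDerivCocycle T X₀) {V : Set X}
    {c : ℝ≥0∞} (hc : ∀ w, branchSum T X₀ t n V w ≤ c) (a : X) :
    branchSum T X₀ t (m + n) V a ≤ c * branchSum T X₀ t m univ a := by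
  rw [hD.branchSum_add, ← poincareSum_eq_branchSum, poincareSum, ← ENNReal.tsum_mul_left]
  refine ENNReal.tsum_le_tsum fun w => ?_
  rw [mul_comm]
  exact mul_le_mul_left (hc w) _

theorem IsDerivCocycle.branchWeight_mul_le (hD : IsDerivCocycle T X₀) {a w : X}
    (hw : w ∈ iterPreimage T X₀ m {a}) (V : Set X) :
    branchWeight T t m w * branchSum T X₀ t n V w ≤ branchSum T X₀ t (m + n) V a := by
  rw [hD.branchSum_add]
  exact ENNReal.le_tsum
    (f := fun w : iterPreimage T X₀ m {a} => branchWeight T t m w * branchSum T X₀ t n V w)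
    ⟨w, hw⟩

theorem branchWeight_le_branchSum {V : Set X} {a w : X} (hw : w ∈ iterPreimage T X₀ n {a})
    (hV : w ∈ V) : branchWeight T t n w ≤ branchSum T X₀ t n V a :=
  ENNReal.le_tsum (f := fun w : ↥(iterPreimage T X₀ n {a} ∩ V) => branchWeight T t n w)
    ⟨w, hw, hV⟩

/-- Over two points `a` and `b` of the set `U`, the inverse branches of `Tⁿ` on `U` put
`T⁻ⁿ(a)` and `T⁻ⁿ(b)` in bijection, so the two sums can be compared term by term. -/
theorem IsDerivCocycle.branchSum_le_of_components (hD : IsDerivCocycle T X₀) (ht : 0 ≤ t)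
    {U : Set X} {𝒢 : Set (Set X)} (h : IsInjectiveComponents T X₀ n U 𝒢) {a b : X} (ha : a ∈ U)
    (hb : b ∈ U) {V W : Set X} {Q : ℝ}
    (hQ : ∀ A ∈ 𝒢, ∀ y ∈ A, ∀ z ∈ A, T^[n] y = a → T^[n] z = b → y ∈ V →
      metricDeriv T^[n] z ≤ Q * metricDeriv T^[n] y ∧ z ∈ W) :
    branchSum T X₀ t n V a ≤ ENNReal.ofReal Q ^ t * branchSum T X₀ t n W b := by
  have hex : ∀ y : ↥(iterPreimage T X₀ n {a} ∩ V), ∃ A ∈ 𝒢, (y : X) ∈ A ∧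
      ∃ z ∈ A, T^[n] z = b := by
    intro y
    obtain ⟨A, hA, hyA⟩ := h.exists_mem ha y.2.1
    obtain ⟨z, hz, hzb⟩ := h.surjOn hA hb
    exact ⟨A, hA, hyA, z, hz, hzb⟩
  choose A hA hyA g hgA hgb using hex
  have hgood := fun y => hQ (A y) (hA y) y (hyA y) (g y) (hgA y) y.2.1.2 (hgb y) y.2.2
  have hgmem : ∀ y, g y ∈ iterPreimage T X₀ n {b} ∩ W := fun y =>
    ⟨⟨(h.subset (hA y) (hgA y)).1, hgb y⟩, (hgood y).2⟩
  let G : ↥(iterPreimage T X₀ n {a} ∩ V) → ↥(iterPreimage T X₀ n {b} ∩ W) :=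
    fun y => ⟨g y, hgmem y⟩
  have hG : Function.Injective G := by
    intro y y' hyy'
    have hg : g y = g y' := congrArg Subtype.val hyy'
    have hAA : A y = A y' := by
      by_contra hne
      exact (h.disjoint (hA y) (hA y') hne).le_bot ⟨hgA y, by rw [hg]; exact hgA y'⟩
    refine Subtype.ext (h.injOn (hA y) (hyA y) (by rw [hAA]; exact hyA y') ?_)
    rw [show T^[n] (y : X) = a from y.2.1.2, show T^[n] (y' : X) = a from y'.2.1.2]
  calc branchSum T X₀ t n V a
      ≤ ∑' y : ↥(iterPreimage T X₀ n {a} ∩ V),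
          ENNReal.ofReal Q ^ t * branchWeight T t n (G y) :=
        ENNReal.tsum_le_tsum fun y =>
          hD.branchWeight_le ht y.2.1.1 (hgmem y).1.1 (hgood y).1
    _ = ENNReal.ofReal Q ^ t * ∑' y, branchWeight T t n (G y) := ENNReal.tsum_mul_left
    _ ≤ ENNReal.ofReal Q ^ t * branchSum T X₀ t n W b :=
        mul_le_mul_right (ENNReal.tsum_comp_le_tsum_of_injective hG
          fun z : ↥(iterPreimage T X₀ n {b} ∩ W) => branchWeight T t n z) _

/-- A value exceeded by a branch sum is exceeded by the sum over finitely many points. -/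
theorem exists_finset_lt_of_lt_branchSum {V : Set X} {a : X} {c : ℝ≥0∞}
    (h : c < branchSum T X₀ t n V a) :
    ∃ F : Finset X, (F : Set X) ⊆ iterPreimage T X₀ n {a} ∩ V ∧
      c < ∑ z ∈ F, branchWeight T t n z := by
  rw [branchSum, ENNReal.tsum_eq_iSup_sum, lt_iSup_iff] at h
  obtain ⟨s, hs⟩ := h
  refine ⟨s.map (Function.Embedding.subtype _), ?_, ?_⟩
  · intro z hz
    rw [Finset.coe_map] at hz
    obtain ⟨w, -, rfl⟩ := hz
    exact w.2
  · rwa [Finset.sum_map]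

theorem sum_branchWeight_le_branchSum {a : X} {F : Finset X}
    (hF : (F : Set X) ⊆ iterPreimage T X₀ n {a}) :
    ∑ z ∈ F, branchWeight T t n z ≤ branchSum T X₀ t n F a := by
  have hset : iterPreimage T X₀ n {a} ∩ F = F := inter_eq_right.2 hF
  rw [branchSum, hset, Finset.tsum_subtype' F (branchWeight T t n)]

/-- A lower bound for the sum over the points of an open set persists nearby, up to the
distortion: finitely many branches carry the bound, and they are continuous. -/
theorem IsDerivCocycle.eventually_le_branchSum (hD : IsDerivCocycle T X₀) (ht : 0 ≤ t)
    {U : Set X} (hU : IsOpen U) {𝒢 : Set (Set X)} (h : IsInjectiveComponents T X₀ n U 𝒢) {a : X}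
    (ha : a ∈ U) {V : Set X} (hV : IsOpen V) {Q : ℝ}
    (hQ : ∀ A ∈ 𝒢, ∀ y ∈ A, ∀ z ∈ A, metricDeriv T^[n] z ≤ Q * metricDeriv T^[n] y)
    {c : ℝ≥0∞} (hc : c < branchSum T X₀ t n V a) :
    ∀ᶠ b in 𝓝 a, c ≤ ENNReal.ofReal Q ^ t * branchSum T X₀ t n V b := by
  obtain ⟨F, hF, hcF⟩ := exists_finset_lt_of_lt_branchSum hc
  have hex : ∀ z ∈ F, ∃ A ∈ 𝒢, z ∈ A := fun z hz => h.exists_mem ha (hF hz).1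
  choose! A hA hzA using hex
  have hnear : ∀ᶠ b in 𝓝 a, ∀ z ∈ F, b ∈ T^[n] '' (A z ∩ V) := by
    rw [Filter.eventually_all_finset]
    intro z hz
    refine (h.isOpen_image hU (hA z hz) hV).mem_nhds ⟨z, ⟨hzA z hz, (hF hz).2⟩, ?_⟩
    exact (hF hz).1.2
  filter_upwards [hnear, hU.mem_nhds ha] with b hb hbU
  refine (hcF.le.trans (sum_branchWeight_le_branchSum fun z hz => (hF hz).1)).trans ?_
  refine hD.branchSum_le_of_components ht h ha hbU fun B hB y hy z hz hya hzb hyF => ?_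
  refine ⟨hQ B hB y hy z hz, ?_⟩
  obtain ⟨z', ⟨hz'A, hz'V⟩, hz'b⟩ := hb y hyF
  have hBA : B = A y := by
    by_contra hne
    exact (h.disjoint hB (hA y hyF) hne).le_bot ⟨hy, hzA y hyF⟩
  rwa [h.injOn hB hz (hBA ▸ hz'A) (hzb.trans hz'b.symm)]

end BranchSum

/-! ### Growth rates -/

/-- Growth rates of a sequence of functions `L n` that behaves like the Poincaré sums: suprema are
submultiplicative, infima are supermultiplicative, and the supremum of `L n` is bounded, up to a
constant, by the infimum of `L (n + M)`. The suprema then have a growth rate by Fekete's lemma, and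
each `L n a` shares it. -/
theorem exists_tendsto_log_div {X : Type*} [Nonempty X] {L : ℕ → X → ℝ≥0∞}
    (hzero : ∀ a, L 0 a = 1)
    (hsub : ∀ m n c, (∀ w, L n w ≤ c) → ∀ a, L (m + n) a ≤ c * L m a)
    (hsuper : ∀ m n c, (∀ w, c ≤ L n w) → ∀ a, c * L m a ≤ L (m + n) a)
    {η c : ℝ≥0∞} {M : ℕ} (hη : 0 < η) (hη1 : ∀ a, η ≤ L 1 a) (hc : 0 < c)
    (hmix : ∀ n a b, c * L n a ≤ L (n + M) b) :
    ∃ p : EReal, ∀ a, Tendsto (fun n : ℕ => ENNReal.log (L n a) / (n : EReal)) atTop (𝓝 p) := by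
  have hpow : ∀ n a, η ^ n ≤ L n a := by
    intro n
    induction n with
    | zero => intro a; simp [hzero]
    | succ n ih =>
      intro a
      rw [pow_succ, add_comm]
      exact (mul_le_mul_right (hη1 a) _).trans (hsuper 1 n _ ih a)
  have hLpos : ∀ n a, 0 < L n a := fun n a => (ENNReal.pow_pos hη n).trans_le (hpow n a)
  have hmixU : ∀ n b, c * ⨆ a, L n a ≤ L (n + M) b := by
    intro n b
    rw [ENNReal.mul_iSup]
    exact iSup_le fun a => hmix n a b
  set U : ℕ → ℝ≥0∞ := fun n => ⨆ a, L n a with hUdef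
  have hLU : ∀ n a, L n a ≤ U n := fun n a => le_iSup (L n) a
  by_cases hfin : ∀ n, U n ≠ ⊤
  · have a₀ : X := Classical.arbitrary X
    have hUpos : ∀ n, 0 < U n := fun n => (hLpos n a₀).trans_le (hLU n a₀)
    have hLfin : ∀ n a, L n a ≠ ⊤ := fun n a => ne_top_of_le_ne_top (hfin n) (hLU n a)
    have hηfin : η ≠ ⊤ := ne_top_of_le_ne_top (hLfin 1 a₀) (hη1 a₀)
    have hcfin : c ≠ ⊤ := by
      intro h
      have := hmix 0 a₀ a₀
      rw [h, hzero, mul_one] at this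
      exact hLfin _ _ (top_le_iff.1 this)
    have hsubU : Subadditive fun n => Real.log (U n).toReal := by
      intro m n
      have hmul : U (m + n) ≤ U m * U n := by
        refine iSup_le fun a => (hsub m n _ (hLU n) a).trans ?_
        rw [mul_comm]
        exact mul_le_mul_left (hLU m a) _
      rw [← Real.log_mul (ENNReal.toReal_pos (hUpos m).ne' (hfin m)).ne'
        (ENNReal.toReal_pos (hUpos n).ne' (hfin n)).ne', ← ENNReal.toReal_mul]
      exact Real.log_le_log (ENNReal.toReal_pos (hUpos _).ne' (hfin _))
        (ENNReal.toReal_mono (ENNReal.mul_ne_top (hfin m) (hfin n)) hmul)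
    have hbdd : BddBelow (range fun n : ℕ => Real.log (U n).toReal / n) := by
      refine ⟨min (Real.log η.toReal) 0, ?_⟩
      rintro _ ⟨n, rfl⟩
      rcases Nat.eq_zero_or_pos n with rfl | hn
      · simp
      · refine (min_le_left _ _).trans ?_
        have hn' : (0 : ℝ) < n := Nat.cast_pos.2 hn
        rw [le_div_iff₀ hn', mul_comm, ← Real.log_pow, ← ENNReal.toReal_pow]
        exact Real.log_le_log (ENNReal.toReal_pos (ENNReal.pow_pos hη n).ne'
          (ENNReal.pow_ne_top hηfin)) (ENNReal.toReal_mono (hfin n)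
            ((hpow n a₀).trans (hLU n a₀)))
    have hlim := hsubU.tendsto_lim hbdd
    refine ⟨(hsubU.lim : ℝ), fun a => ?_⟩
    have hreal : Tendsto (fun n : ℕ => Real.log (L n a).toReal / n) atTop (𝓝 hsubU.lim) := by
      have hlow : Tendsto (fun n : ℕ => Real.log c.toReal / (n + M : ℕ) +
          Real.log (U n).toReal / n * ((n : ℝ) / (n + M : ℕ))) atTop (𝓝 hsubU.lim) := by
        have h₁ : Tendsto (fun n : ℕ => Real.log c.toReal / ((n + M : ℕ) : ℝ)) atTop (𝓝 0) :=
          (tendsto_const_div_atTop_nhds_zero_nat _).comp (tendsto_add_atTop_nat M)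
        have h₂ : Tendsto (fun n : ℕ => (n : ℝ) / ((n + M : ℕ) : ℝ)) atTop (𝓝 1) := by
          simpa using tendsto_natCast_div_add_atTop (𝕜 := ℝ) (M : ℝ)
        simpa using h₁.add (hlim.mul h₂)
      rw [← tendsto_add_atTop_iff_nat M]
      refine tendsto_of_tendsto_of_tendsto_of_le_of_le' hlow
        ((tendsto_add_atTop_iff_nat M).2 hlim) ?_ ?_
      · filter_upwards [eventually_gt_atTop 0] with n hn
        have hn' : (0 : ℝ) < n := Nat.cast_pos.2 hn
        have hnM : (0 : ℝ) < (n + M : ℕ) := Nat.cast_pos.2 (by omega)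
        rw [div_mul_div_cancel₀ hn'.ne', ← add_div, ← Real.log_mul
          (ENNReal.toReal_pos hc.ne' hcfin).ne' (ENNReal.toReal_pos (hUpos n).ne' (hfin n)).ne',
          ← ENNReal.toReal_mul]
        refine div_le_div_of_nonneg_right (Real.log_le_log (ENNReal.toReal_pos
          (mul_ne_zero hc.ne' (hUpos n).ne') (ENNReal.mul_ne_top hcfin (hfin n))) ?_) hnM.le
        exact ENNReal.toReal_mono (hLfin _ _) (hmixU n a)
      · refine Eventually.of_forall fun n => div_le_div_of_nonneg_right ?_ (Nat.cast_nonneg _)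
        exact Real.log_le_log (ENNReal.toReal_pos (hLpos _ _).ne' (hLfin _ _))
          (ENNReal.toReal_mono (hfin _) (hLU _ a))
    have hcoe := (continuous_coe_real_ereal.tendsto hsubU.lim).comp hreal
    refine hcoe.congr fun n => ?_
    simp only [Function.comp_apply]
    rw [EReal.coe_div, ENNReal.log_pos_real (hLpos n a).ne' (hLfin n a)]
    rfl
  · push Not at hfin
    obtain ⟨n₀, hn₀⟩ := hfin
    have htop : ∀ b, L (n₀ + M) b = ⊤ := by
      intro b
      have := hmixU n₀ b
      rw [show (⨆ a, L n₀ a) = ⊤ from hn₀, ENNReal.mul_top hc.ne'] at this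
      exact top_le_iff.1 this
    refine ⟨⊤, fun a => tendsto_const_nhds.congr' ?_⟩
    filter_upwards [eventually_ge_atTop (n₀ + M), eventually_gt_atTop 0] with n hn hn0
    have h := hsuper (n - (n₀ + M)) (n₀ + M) ⊤ (fun w => (htop w).ge) a
    rw [ENNReal.top_mul (hLpos _ a).ne', Nat.sub_add_cancel hn, top_le_iff] at h
    rw [h, ENNReal.log_top, EReal.top_div_of_pos_ne_top (by exact_mod_cast hn0)
      (EReal.natCast_ne_top n)]

theorem log_div_natCast_lt_iff {x : ℝ≥0∞} {n : ℕ} (hn : 0 < n) (q : ℝ) :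
    ENNReal.log x / (n : EReal) < (q : EReal) ↔ x < ENNReal.ofReal (Real.exp (q * n)) := by
  have hlog : ENNReal.log (ENNReal.ofReal (Real.exp (q * n))) = ((q * n : ℝ) : EReal) := by
    rw [ENNReal.log_ofReal_of_pos (Real.exp_pos _), Real.log_exp]
  rw [EReal.div_lt_iff (by exact_mod_cast hn) (EReal.natCast_ne_top n),
    ← ENNReal.log_lt_log_iff, hlog, EReal.coe_mul]
  rfl

theorem lt_log_div_natCast_iff {x : ℝ≥0∞} {n : ℕ} (hn : 0 < n) (q : ℝ) :
    (q : EReal) < ENNReal.log x / (n : EReal) ↔ ENNReal.ofReal (Real.exp (q * n)) < x := by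
  have hlog : ENNReal.log (ENNReal.ofReal (Real.exp (q * n))) = ((q * n : ℝ) : EReal) := by
    rw [ENNReal.log_ofReal_of_pos (Real.exp_pos _), Real.log_exp]
  rw [EReal.lt_div_iff (by exact_mod_cast hn) (EReal.natCast_ne_top n),
    ← ENNReal.log_lt_log_iff, hlog, EReal.coe_mul]
  rfl

theorem tendsto_top_of_tendsto_log_div {u : ℕ → ℝ≥0∞} {p : EReal}
    (h : Tendsto (fun n : ℕ => ENNReal.log (u n) / (n : EReal)) atTop (𝓝 p)) (hp : 0 < p) :
    Tendsto u atTop (𝓝 ⊤) := by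
  obtain ⟨q, hq0, hqp⟩ := EReal.lt_iff_exists_real_btwn.1 hp
  have hq : 0 < q := by exact_mod_cast hq0
  have hexp : Tendsto (fun n : ℕ => ENNReal.ofReal (Real.exp (q * n))) atTop (𝓝 ⊤) :=
    ENNReal.tendsto_ofReal_atTop.comp (Real.tendsto_exp_atTop.comp
      (tendsto_natCast_atTop_atTop.const_mul_atTop hq))
  refine tendsto_of_tendsto_of_tendsto_of_le_of_le' hexp tendsto_const_nhds ?_
    (Eventually.of_forall fun _ => le_top)
  filter_upwards [h.eventually (lt_mem_nhds hqp), eventually_gt_atTop 0] with n hn hn0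
  exact ((lt_log_div_natCast_iff hn0 q).1 hn).le

theorem tendsto_zero_of_tendsto_log_div {u : ℕ → ℝ≥0∞} {p : EReal}
    (h : Tendsto (fun n : ℕ => ENNReal.log (u n) / (n : EReal)) atTop (𝓝 p)) (hp : p < 0) :
    Tendsto u atTop (𝓝 0) := by
  obtain ⟨q, hpq, hq0⟩ := EReal.lt_iff_exists_real_btwn.1 hp
  have hq : q < 0 := by exact_mod_cast hq0
  have hexp : Tendsto (fun n : ℕ => ENNReal.ofReal (Real.exp (q * n))) atTop (𝓝 0) := by
    rw [← ENNReal.ofReal_zero]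
    exact ENNReal.tendsto_ofReal (Real.tendsto_exp_atBot.comp
      (tendsto_natCast_atTop_atTop.const_mul_atTop_of_neg hq))
  refine tendsto_of_tendsto_of_tendsto_of_le_of_le' tendsto_const_nhds hexp
    (Eventually.of_forall fun _ => zero_le) ?_
  filter_upwards [h.eventually (gt_mem_nhds hpq), eventually_gt_atTop 0] with n hn hn0
  exact ((log_div_natCast_lt_iff hn0 q).1 hn).le

/-! ### Comparison of Poincaré sums and existence of the pressure -/

theorem one_le_ofReal_rpow {Q t : ℝ} (hQ : 1 ≤ Q) (ht : 0 ≤ t) : 1 ≤ ENNReal.ofReal Q ^ t := by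
  simpa using ENNReal.rpow_le_rpow (ENNReal.one_le_ofReal.2 hQ) ht

section Comparison

variable {X : Type*} [MetricSpace X] {T : X → X} {X₀ : Set X} {δ C : X → ℝ}
  {𝒜 : X → ℕ → Set (Set X)} {t : ℝ}

theorem IsDerivCocycle.exists_distortion (hD : IsDerivCocycle T X₀)
    (hW : IsWeakWaltersExpanding T X₀ δ 𝒜 C) (hconf : IsMetricConformal T X₀ 𝒜) (e : X) :
    ∃ Q : ℝ, 1 ≤ Q ∧ ∀ n, 1 ≤ n → ∀ A ∈ 𝒜 e n, ∀ y ∈ A, ∀ y' ∈ A,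
      metricDeriv T^[n] y ≤ Q * metricDeriv T^[n] y' := by
  obtain ⟨M, hM⟩ := hconf.distortion e
  refine ⟨max M 1, le_max_right _ _, fun n hn A hA y hy y' hy' => ?_⟩
  refine (hM n hn A hA y hy y' hy').trans ?_
  exact mul_le_mul_of_nonneg_right (le_max_left _ _)
    (hD.pos n y' ((hW.components e n hn).subset hA hy').1).le

theorem IsDerivCocycle.exists_distortion_of_isCompact (hD : IsDerivCocycle T X₀)
    (hW : IsWeakWaltersExpanding T X₀ δ 𝒜 C) (hconf : IsMetricConformal T X₀ 𝒜) {K : Set X}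
    (hK : IsCompact K) :
    ∃ (E : Finset X) (Q : ℝ), 1 ≤ Q ∧ ∀ a ∈ K, ∃ e ∈ E, a ∈ ball e (δ e) ∧
      ∀ n, 1 ≤ n → ∀ A ∈ 𝒜 e n, ∀ y ∈ A, ∀ y' ∈ A,
        metricDeriv T^[n] y ≤ Q * metricDeriv T^[n] y' := by
  choose M hM1 hM using fun e => hD.exists_distortion hW hconf e
  obtain ⟨E, -, hE⟩ := hK.elim_nhds_subcover (fun e => ball e (δ e))
    fun e _ => ball_mem_nhds e (hW.δ_pos e)
  obtain ⟨Q, hQ⟩ := (E.finite_toSet.image M).bddAbove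
  refine ⟨E, max Q 1, le_max_right _ _, fun a ha => ?_⟩
  obtain ⟨e, he, hae⟩ := mem_iUnion₂.1 (hE ha)
  refine ⟨e, he, hae, fun n hn A hA y hy y' hy' => (hM e n hn A hA y hy y' hy').trans ?_⟩
  exact mul_le_mul_of_nonneg_right ((hQ (mem_image_of_mem M he)).trans (le_max_left _ _))
    (hD.pos n y' ((hW.components e n hn).subset hA hy').1).le

theorem IsDerivCocycle.branchSum_le_of_mem_ball (hD : IsDerivCocycle T X₀) (ht : 0 ≤ t)
    (hW : IsWeakWaltersExpanding T X₀ δ 𝒜 C) {e a b : X} (ha : a ∈ ball e (δ e))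
    (hb : b ∈ ball e (δ e)) {Q : ℝ} (hQ1 : 1 ≤ Q)
    (hQ : ∀ n, 1 ≤ n → ∀ A ∈ 𝒜 e n, ∀ y ∈ A, ∀ y' ∈ A,
      metricDeriv T^[n] y ≤ Q * metricDeriv T^[n] y') (n : ℕ) :
    branchSum T X₀ t n univ a ≤ ENNReal.ofReal Q ^ t * branchSum T X₀ t n univ b := by
  rcases Nat.eq_zero_or_pos n with rfl | hn
  · rw [hD.branchSum_zero, hD.branchSum_zero, mul_one]
    exact one_le_ofReal_rpow hQ1 ht
  · exact hD.branchSum_le_of_components ht (hW.components e n hn) ha hb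
      fun A hA y hy z hz _ _ _ => ⟨hQ n hn A hA z hz y hy, mem_univ _⟩

/-- All Poincaré sums are comparable, uniformly in `n`, with those at finitely many points: a ball
around the base point of the branch condition is covered by finitely many balls with bounded
distortion, and outside of it the branch condition compares any two points. -/
theorem IsDerivCocycle.exists_finset_comparable [ProperSpace X] (hD : IsDerivCocycle T X₀)
    (ht : 0 ≤ t) (hW : IsWeakWaltersExpanding T X₀ δ 𝒜 C) (hconf : IsMetricConformal T X₀ 𝒜)
    (hbranch : HasComparableBranches T X₀) :
    ∃ (E : Finset X) (q : ℝ≥0∞), q ≠ 0 ∧ q ≠ ⊤ ∧ ∀ b, ∃ e ∈ E, ∀ n,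
      branchSum T X₀ t n univ b ≤ q * branchSum T X₀ t n univ e ∧
      branchSum T X₀ t n univ e ≤ q * branchSum T X₀ t n univ b := by
  classical
  obtain ⟨x, R, K, R₁, φ, -, -, -, hbr⟩ := hbranch
  obtain ⟨E, Q, hQ1, hQ⟩ :=
    hD.exists_distortion_of_isCompact hW hconf (isCompact_closedBall x R)
  have hball : ∀ b ∈ closedBall x R, ∃ e ∈ E, ∀ n,
      branchSum T X₀ t n univ b ≤ ENNReal.ofReal Q ^ t * branchSum T X₀ t n univ e ∧
      branchSum T X₀ t n univ e ≤ ENNReal.ofReal Q ^ t * branchSum T X₀ t n univ b := by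
    intro b hb
    obtain ⟨e, he, hbe, hdist⟩ := hQ b hb
    have hee := mem_ball_self (x := e) (hW.δ_pos e)
    exact ⟨e, he, fun n => ⟨hD.branchSum_le_of_mem_ball ht hW hbe hee hQ1 hdist n,
      hD.branchSum_le_of_mem_ball ht hW hee hbe hQ1 hdist n⟩⟩
  have hQt : 1 ≤ ENNReal.ofReal Q ^ t :=
    one_le_ofReal_rpow hQ1 ht
  have hQtop : ENNReal.ofReal Q ^ t ≠ ⊤ := ENNReal.rpow_ne_top_of_nonneg ht ENNReal.ofReal_ne_top
  by_cases hout : ∃ b₀, b₀ ∉ closedBall x R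
  · obtain ⟨b₀, hb₀⟩ := hout
    have hb₀' : b₀ ∉ ball x R := fun h => hb₀ (ball_subset_closedBall h)
    refine ⟨insert b₀ E, max (ENNReal.ofReal Q ^ t) (ENNReal.ofReal K ^ t),
      (zero_lt_one.trans_le (hQt.trans (le_max_left _ _))).ne', ?_, fun b => ?_⟩
    · exact (max_lt hQtop.lt_top (ENNReal.rpow_ne_top_of_nonneg ht
        ENNReal.ofReal_ne_top).lt_top).ne
    by_cases hb : b ∈ closedBall x R
    · obtain ⟨e, he, h⟩ := hball b hb
      refine ⟨e, Finset.mem_insert_of_mem he, fun n => ⟨(h n).1.trans ?_, (h n).2.trans ?_⟩⟩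
      · exact mul_le_mul_left (le_max_left _ _) _
      · exact mul_le_mul_left (le_max_left _ _) _
    · refine ⟨b₀, Finset.mem_insert_self _ _, fun n => ?_⟩
      rcases Nat.eq_zero_or_pos n with rfl | hn
      · rw [hD.branchSum_zero, hD.branchSum_zero, mul_one]
        exact ⟨hQt.trans (le_max_left _ _), hQt.trans (le_max_left _ _)⟩
      obtain ⟨U, 𝒢, -, hbU, hb₀U, hcomp, hdist⟩ :=
        hbr b (fun h => hb (ball_subset_closedBall h)) b₀ hb₀' n hn
      constructor
      · refine (hD.branchSum_le_of_components ht hcomp hbU hb₀U (W := univ) (Q := K)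
          fun A hA y hy z hz hyb hzb _ => ⟨(hdist A hA y hy z hz hyb hzb).2.1, mem_univ _⟩).trans ?_
        exact mul_le_mul_left (le_max_right _ _) _
      · refine (hD.branchSum_le_of_components ht hcomp hb₀U hbU (W := univ) (Q := K)
          fun A hA y hy z hz hyb hzb _ => ⟨(hdist A hA z hz y hy hzb hyb).1, mem_univ _⟩).trans ?_
        exact mul_le_mul_left (le_max_right _ _) _
  · push Not at hout
    exact ⟨E, ENNReal.ofReal Q ^ t, (zero_lt_one.trans_le hQt).ne', hQtop,
      fun b => hball b (hout b)⟩

/-- The covering property, for one point `e`: all points of a finite set have a preimage near `e`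
under one iterate of `T`. -/
theorem IsDerivCocycle.exists_mul_branchSum_le (hD : IsDerivCocycle T X₀) (hX₀ : Dense X₀)
    (ht : 0 ≤ t) (hW : IsWeakWaltersExpanding T X₀ δ 𝒜 C) (hconf : IsMetricConformal T X₀ 𝒜)
    (E : Finset X) (e : X) :
    ∃ (M : ℕ) (c : ℝ≥0∞), 0 < c ∧ ∀ f ∈ E, ∀ n,
      c * branchSum T X₀ t n univ e ≤ branchSum T X₀ t (n + M) univ f := by
  obtain ⟨Q, hQ1, hQ⟩ := hD.exists_distortion hW hconf e
  obtain ⟨e', he', he'X₀⟩ := hX₀.exists_mem_open isOpen_ball ⟨e, mem_ball_self (hW.δ_pos e)⟩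
  obtain ⟨r, hr, hrball⟩ := Metric.isOpen_iff.1 isOpen_ball e' he'X₀
  obtain ⟨M, -, hM⟩ := hW.covering e' he' r hr E E.finite_toSet.isCompact
  have hex : ∀ f ∈ E, ∃ z, z ∈ ball e (δ e) ∧ z ∈ iterPreimage T X₀ M {f} := by
    intro f hf
    obtain ⟨z, ⟨hzr, hzM⟩, hzf⟩ := hM hf
    exact ⟨z, hrball hzr, hzM, hzf⟩
  choose! z hzball hzf using hex
  have hq0 : ENNReal.ofReal Q ^ t ≠ 0 := (zero_lt_one.trans_le
    (one_le_ofReal_rpow hQ1 ht)).ne'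
  have hqtop : ENNReal.ofReal Q ^ t ≠ ⊤ := ENNReal.rpow_ne_top_of_nonneg ht ENNReal.ofReal_ne_top
  refine ⟨M, (E.inf fun f => branchWeight T t M (z f)) / ENNReal.ofReal Q ^ t, ?_,
    fun f hf n => ?_⟩
  · refine ENNReal.div_pos ?_ hqtop
    exact ((Finset.lt_inf_iff ENNReal.zero_lt_top).2
      fun f hf => hD.branchWeight_pos (hzf f hf).1).ne'
  · have h₁ := hD.branchSum_le_of_mem_ball ht hW (mem_ball_self (hW.δ_pos e)) (hzball f hf) hQ1 hQ n
    calc (E.inf fun f => branchWeight T t M (z f)) / ENNReal.ofReal Q ^ t *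
          branchSum T X₀ t n univ e
        ≤ (E.inf fun f => branchWeight T t M (z f)) / ENNReal.ofReal Q ^ t *
          (ENNReal.ofReal Q ^ t * branchSum T X₀ t n univ (z f)) := mul_le_mul_right h₁ _
      _ = (E.inf fun f => branchWeight T t M (z f)) * branchSum T X₀ t n univ (z f) := by
          rw [← mul_assoc, ENNReal.div_mul_cancel hq0 hqtop]
      _ ≤ branchWeight T t M (z f) * branchSum T X₀ t n univ (z f) :=
          mul_le_mul_left (Finset.inf_le (f := fun f => branchWeight T t M (z f)) hf) _
      _ ≤ branchSum T X₀ t (n + M) univ f := by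
          rw [add_comm]
          exact hD.branchWeight_mul_le (hzf f hf) univ

theorem IsDerivCocycle.branchSum_pos (hD : IsDerivCocycle T X₀) (hX₀ : Dense X₀)
    (hW : IsWeakWaltersExpanding T X₀ δ 𝒜 C) (n : ℕ) (a : X) : 0 < branchSum T X₀ t n univ a := by
  induction n generalizing a with
  | zero =>
    rw [hD.branchSum_zero]
    exact one_pos
  | succ n ih =>
    obtain ⟨z, hz, hza⟩ := exists_preimage hX₀ hW a
    have hz' : z ∈ iterPreimage T X₀ 1 {a} := ⟨mem_iterDomain_one.2 hz, hza⟩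
    rw [add_comm]
    exact (ENNReal.mul_pos (hD.branchWeight_pos hz'.1).ne' (ih z).ne').trans_le
      (hD.branchWeight_mul_le hz' univ)

theorem IsDerivCocycle.exists_le_branchSum_one [ProperSpace X] (hD : IsDerivCocycle T X₀)
    (hX₀ : Dense X₀) (ht : 0 ≤ t) (hW : IsWeakWaltersExpanding T X₀ δ 𝒜 C)
    (hconf : IsMetricConformal T X₀ 𝒜) (hbranch : HasComparableBranches T X₀) :
    ∃ η : ℝ≥0∞, 0 < η ∧ ∀ a, η ≤ branchSum T X₀ t 1 univ a := by
  obtain ⟨E, q, hq0, hqtop, hE⟩ := hD.exists_finset_comparable ht hW hconf hbranch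
  refine ⟨(E.inf fun e => branchSum T X₀ t 1 univ e) / q, ?_, fun b => ?_⟩
  · exact ENNReal.div_pos ((Finset.lt_inf_iff ENNReal.zero_lt_top).2
      fun f _ => hD.branchSum_pos hX₀ hW 1 f).ne' hqtop
  · obtain ⟨e, he, h⟩ := hE b
    rw [ENNReal.div_le_iff hq0 hqtop, mul_comm]
    exact (Finset.inf_le (f := fun e => branchSum T X₀ t 1 univ e) he).trans (h 1).2

theorem IsDerivCocycle.pow_le_branchSum (hD : IsDerivCocycle T X₀) {η : ℝ≥0∞} {m : ℕ} {V : Set X}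
    (hV : ∀ a, η ≤ branchSum T X₀ t m V a) (k j : ℕ) (a : X) :
    η ^ (k + 1) * branchSum T X₀ t j univ a ≤ branchSum T X₀ t (j + (k + 1) * m) V a := by
  refine hD.mul_branchSum_le_branchSum_add (fun w _ => ?_) a
  induction k generalizing w with
  | zero => simpa using hV w
  | succ k ih =>
    rw [pow_succ, show (k + 1 + 1) * m = m + (k + 1) * m by ring]
    refine (mul_le_mul_right (hV w) _).trans ?_
    refine (mul_le_mul_right (branchSum_mono (subset_univ V) w) _).trans ?_
    exact hD.mul_branchSum_le_branchSum_add (fun w _ => ih w (mem_univ w)) w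

/-- Up to a constant, every Poincaré sum of order `n` is bounded by every Poincaré sum of order
`n + M`. -/
theorem IsDerivCocycle.exists_mixing [ProperSpace X] (hD : IsDerivCocycle T X₀)
    (hX₀ : Dense X₀) (ht : 0 ≤ t) (hW : IsWeakWaltersExpanding T X₀ δ 𝒜 C)
    (hconf : IsMetricConformal T X₀ 𝒜) (hbranch : HasComparableBranches T X₀) :
    ∃ (M : ℕ) (c : ℝ≥0∞), 0 < c ∧ ∀ n a b,
      c * branchSum T X₀ t n univ a ≤ branchSum T X₀ t (n + M) univ b := by
  obtain ⟨E, q, hq0, hqtop, hE⟩ := hD.exists_finset_comparable ht hW hconf hbranch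
  obtain ⟨η, hη, hη1⟩ := hD.exists_le_branchSum_one hX₀ ht hW hconf hbranch
  have hpow : ∀ k b, η ^ k ≤ branchSum T X₀ t k univ b := by
    intro k b
    rcases k with _ | k
    · rw [hD.branchSum_zero, pow_zero]
    · simpa [hD.branchSum_zero] using hD.pow_le_branchSum hη1 k 0 b
  choose N c hc hNc using fun e => hD.exists_mul_branchSum_le hX₀ ht hW hconf E e
  set M := E.sup N with hM
  set γ := E.inf fun e => c e * η ^ (M - N e)
  have hγ : 0 < γ := (Finset.lt_inf_iff ENNReal.zero_lt_top).2 fun e _ =>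
    ENNReal.mul_pos (hc e).ne' (ENNReal.pow_pos hη _).ne'
  refine ⟨M, γ / q / q, ENNReal.div_pos (ENNReal.div_pos hγ.ne' hqtop).ne' hqtop,
    fun n a b => ?_⟩
  obtain ⟨e, he, hae⟩ := hE a
  have hew : ∀ w, c e / q * branchSum T X₀ t n univ e ≤ branchSum T X₀ t (n + N e) univ w := by
    intro w
    obtain ⟨f, hf, hwf⟩ := hE w
    rw [ENNReal.mul_comm_div, ← mul_div_assoc, ENNReal.div_le_iff hq0 hqtop,
      mul_comm (branchSum T X₀ t (n + N e) univ w)]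
    exact (hNc e f hf n).trans (hwf _).2
  have hNM : N e ≤ M := Finset.le_sup he
  have hstep := hD.mul_branchSum_le_branchSum_add (m := M - N e) (Y := univ)
    (fun w _ => hew w) b
  rw [show M - N e + (n + N e) = n + M by omega] at hstep
  calc γ / q / q * branchSum T X₀ t n univ a
      ≤ γ / q / q * (q * branchSum T X₀ t n univ e) := mul_le_mul_right (hae n).1 _
    _ = γ / q * branchSum T X₀ t n univ e := by
        rw [← mul_assoc, ENNReal.div_mul_cancel hq0 hqtop]
    _ ≤ c e * η ^ (M - N e) / q * branchSum T X₀ t n univ e :=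
        mul_le_mul_left (ENNReal.div_le_div_right
          (Finset.inf_le (f := fun e => c e * η ^ (M - N e)) he) _) _
    _ = c e / q * branchSum T X₀ t n univ e * η ^ (M - N e) := by
        simp only [div_eq_mul_inv]
        ring
    _ ≤ c e / q * branchSum T X₀ t n univ e * branchSum T X₀ t (M - N e) univ b :=
        mul_le_mul_right (hpow _ b) _
    _ ≤ branchSum T X₀ t (n + M) univ b := hstep

theorem IsDerivCocycle.exists_pressure [ProperSpace X] [Nonempty X] (hD : IsDerivCocycle T X₀)
    (hX₀ : Dense X₀) (ht : 0 ≤ t) (hW : IsWeakWaltersExpanding T X₀ δ 𝒜 C)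
    (hconf : IsMetricConformal T X₀ 𝒜) (hbranch : HasComparableBranches T X₀) :
    ∃ p : EReal, ∀ a, Tendsto (fun n : ℕ => ENNReal.log (branchSum T X₀ t n univ a) / (n : EReal))
      atTop (𝓝 p) := by
  obtain ⟨η, hη, hη1⟩ := hD.exists_le_branchSum_one hX₀ ht hW hconf hbranch
  obtain ⟨M, c, hc, hmix⟩ := hD.exists_mixing hX₀ ht hW hconf hbranch
  exact exists_tendsto_log_div (L := fun n a => branchSum T X₀ t n univ a) hD.branchSum_zero
    (fun m n c h a => hD.branchSum_add_le_mul h a)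
    (fun m n c h a => hD.mul_branchSum_le_branchSum_add (fun w _ => h w) a) hη hη1 hc hmix

/-- Raising the exponent from `t'` to `t` multiplies the terms of order `n * N` by at most
`(ϱ C(a) ^ n)^{-(t - t')}`, because the derivatives grow exponentially along the multiples of
`N`. Hence the pressure is negative beyond any exponent at which it is nonpositive. -/
theorem IsDerivCocycle.pressure_neg (hD : IsDerivCocycle T X₀)
    (hW : IsWeakWaltersExpanding T X₀ δ 𝒜 C) {a : X} (hC : 1 < C a) {t' : ℝ} (htt' : t' < t)
    {p p' : EReal}
    (hp : Tendsto (fun n : ℕ => ENNReal.log (branchSum T X₀ t n univ a) / (n : EReal))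
      atTop (𝓝 p))
    (hp' : Tendsto (fun n : ℕ => ENNReal.log (branchSum T X₀ t' n univ a) / (n : EReal))
      atTop (𝓝 p')) (hp'0 : p' ≤ 0) : p < 0 := by
  obtain ⟨ϱ, hϱ, N, hN, hexp⟩ := hW.expanding a
  have hN' : (0 : ℝ) < N := Nat.cast_pos.2 hN
  set s := t - t' with hs
  have hs0 : 0 < s := sub_pos.2 htt'
  -- The exponential gain is `2 κ` per unit of time; half of it is spent on the pressure at `t'`
  -- and a quarter on the constant `ϱ`.
  set κ := s * Real.log (C a) / (2 * N) with hκ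
  have hlogC : 0 < Real.log (C a) := Real.log_pos hC
  have hκ0 : 0 < κ := by positivity
  have hmul : Tendsto (fun n : ℕ => n * N) atTop atTop :=
    tendsto_id.atTop_mul_const' hN
  have hterm : ∀ n : ℕ, 1 ≤ n → branchSum T X₀ t (n * N) univ a ≤
      ENNReal.ofReal ((ϱ * C a ^ n) ^ (-s)) * branchSum T X₀ t' (n * N) univ a := by
    intro n hn
    have hcomp := hW.components a (n * N) (Nat.mul_pos hn hN)
    have hc0 : 0 < ϱ * C a ^ n := by positivity
    rw [branchSum, branchSum, ← ENNReal.tsum_mul_left]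
    refine ENNReal.tsum_le_tsum fun z => ?_
    obtain ⟨A, hA, hzA⟩ := hcomp.exists_mem (mem_ball_self (hW.δ_pos a)) z.2.1
    have hle := hD.le_metricDeriv hcomp hA (hexp n hn A hA) hzA
    have hpos := hD.pos _ z z.2.1.1
    rw [branchWeight, branchWeight, ENNReal.ofReal_rpow_of_pos hpos,
      ENNReal.ofReal_rpow_of_pos hpos, ← ENNReal.ofReal_mul (by positivity)]
    refine ENNReal.ofReal_le_ofReal ?_
    rw [show -t = -s + -t' by rw [hs]; ring, Real.rpow_add hpos]
    exact mul_le_mul_of_nonneg_right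
      (Real.rpow_le_rpow_of_nonpos hc0 hle (neg_nonpos.2 hs0.le)) (by positivity)
  have hϱev : ∀ᶠ n : ℕ in atTop, -s * Real.log ϱ ≤ κ / 2 * (n * N : ℕ) := by
    have : Tendsto (fun n : ℕ => κ / 2 * ((n * N : ℕ) : ℝ)) atTop atTop :=
      (tendsto_natCast_atTop_atTop.comp hmul).const_mul_atTop (half_pos hκ0)
    exact this.eventually_ge_atTop _
  have hκp : p' < (κ : EReal) := hp'0.trans_lt (by exact_mod_cast hκ0)
  have hle : p ≤ ((-(κ / 2) : ℝ) : EReal) := by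
    refine le_of_tendsto (hp.comp hmul) ?_
    filter_upwards [(hp'.comp hmul).eventually (gt_mem_nhds hκp), hϱev, eventually_ge_atTop 1]
      with n hn hϱn hn1
    have hnN : 0 < n * N := Nat.mul_pos hn1 hN
    have h' := (log_div_natCast_lt_iff hnN κ).1 hn
    refine not_lt.1 fun hcon => ?_
    have hlt := (lt_log_div_natCast_iff hnN _).1 hcon
    refine absurd (hlt.trans_le ((hterm n hn1).trans (mul_le_mul_right h'.le _))) ?_
    rw [← ENNReal.ofReal_mul (by positivity), not_lt]
    refine ENNReal.ofReal_le_ofReal ?_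
    rw [Real.rpow_def_of_pos (by positivity), ← Real.exp_add, Real.exp_le_exp,
      Real.log_mul hϱ.ne' (by positivity), Real.log_pow]
    have h2 : s * Real.log (C a) * n = 2 * κ * (n * N : ℕ) := by
      rw [hκ]
      push_cast
      field_simp
    nlinarith [hϱn, h2]
  refine hle.trans_lt ?_
  exact_mod_cast neg_lt_zero.2 (half_pos hκ0)

end Comparison

/-! ### Lower bounds for Hausdorff measures -/

/-- A mass distribution argument without a measure. Suppose that the sets `B z ⊆ K`, `z ∈ F`, are
`ε`-separated, that `f` maps each of them onto `K` with Lipschitz constant `c z`, and that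
`∑ z, (c z)^{-t} ≥ 1`. Then finite covers of `K` have `t`-sums at least `ε ^ t`: if the members of
a cover have diameter less than `ε`, each of them meets at most one `B z`; the images under `f` of
the members that meet `B z` form a cover of `K` with fewer members. -/
theorem rpow_le_sum_ediam_rpow {X ι : Type*} [MetricSpace X] {K : Set X} (hK : K.Nonempty)
    {F : Finset X} (hF : 1 < F.card) {B : X → Set X} {f : X → X} {c : X → ℝ≥0∞} {t : ℝ}
    (ht : 0 ≤ t) {ε : ℝ≥0∞} (hBK : ∀ z ∈ F, B z ⊆ K) (hf : ∀ z ∈ F, K ⊆ f '' B z)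
    (hε : ∀ z ∈ F, ∀ z' ∈ F, z ≠ z' → ∀ y ∈ B z, ∀ y' ∈ B z', ε ≤ edist y y')
    (hc : ∀ z ∈ F, ∀ y ∈ B z, ∀ y' ∈ B z, edist (f y) (f y') ≤ c z * edist y y')
    (hc0 : ∀ z ∈ F, c z ≠ 0) (hctop : ∀ z ∈ F, c z ≠ ⊤) (hsum : 1 ≤ ∑ z ∈ F, c z ^ (-t))
    (I : Finset ι) (V : ι → Set X) (hV : K ⊆ ⋃ i ∈ I, V i) :
    ε ^ t ≤ ∑ i ∈ I, ediam (V i) ^ t := by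
  classical
  induction hn : I.card using Nat.strong_induction_on generalizing I V with
  | _ n ih =>
    by_cases hbig : ∃ i ∈ I, ε ≤ ediam (V i)
    · obtain ⟨i, hi, hεi⟩ := hbig
      exact (ENNReal.rpow_le_rpow hεi ht).trans
        (Finset.single_le_sum (f := fun i => ediam (V i) ^ t) (fun _ _ => zero_le) hi)
    push Not at hbig
    set J : X → Finset ι := fun z => I.filter fun i => (V i ∩ B z).Nonempty with hJ
    have hdisj : ∀ z ∈ F, ∀ z' ∈ F, z ≠ z' → Disjoint (J z) (J z') := by
      intro z hz z' hz' hzz'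
      rw [Finset.disjoint_left]
      intro i hi hi'
      obtain ⟨hiI, y, hyV, hyB⟩ := Finset.mem_filter.1 hi
      obtain ⟨-, y', hyV', hyB'⟩ := Finset.mem_filter.1 hi'
      exact absurd ((hε z hz z' hz' hzz' y hyB y' hyB').trans (edist_le_ediam_of_mem hyV hyV'))
        (not_le.2 (hbig i hiI))
    have hmem : ∀ z ∈ F, ∀ y ∈ B z, ∃ i ∈ J z, y ∈ V i := by
      intro z hz y hy
      obtain ⟨i, hi, hyi⟩ := mem_iUnion₂.1 (hV (hBK z hz hy))
      exact ⟨i, Finset.mem_filter.2 ⟨hi, y, hyi, hy⟩, hyi⟩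
    have hJne : ∀ z ∈ F, (J z).Nonempty := by
      intro z hz
      obtain ⟨k, hk⟩ := hK
      obtain ⟨y, hy, -⟩ := hf z hz hk
      obtain ⟨i, hi, -⟩ := hmem z hz y hy
      exact ⟨i, hi⟩
    have hcard : ∀ z ∈ F, (J z).card < n := by
      intro z hz
      obtain ⟨z', hz', hne⟩ := Finset.exists_mem_ne hF z
      obtain ⟨i, hi⟩ := hJne z' hz'
      rw [← hn]
      refine Finset.card_lt_card ⟨Finset.filter_subset _ _, fun h => ?_⟩
      exact Finset.disjoint_left.1 (hdisj z' hz' z hz hne) hi (h (Finset.mem_filter.1 hi).1)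
    have hstep : ∀ z ∈ F, c z ^ (-t) * ε ^ t ≤ ∑ i ∈ J z, ediam (V i) ^ t := by
      intro z hz
      have hcover : K ⊆ ⋃ i ∈ J z, f '' (V i ∩ B z) := by
        intro k hk
        obtain ⟨y, hy, rfl⟩ := hf z hz hk
        obtain ⟨i, hi, hyi⟩ := hmem z hz y hy
        exact mem_iUnion₂.2 ⟨i, hi, y, ⟨hyi, hy⟩, rfl⟩
      have hsmall := ih _ (hcard z hz) (J z) (fun i => f '' (V i ∩ B z)) hcover rfl
      have hdiam : ∀ i, ediam (f '' (V i ∩ B z)) ≤ c z * ediam (V i) := by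
        intro i
        refine ediam_le ?_
        rintro _ ⟨y, ⟨hyV, hyB⟩, rfl⟩ _ ⟨y', ⟨hyV', hyB'⟩, rfl⟩
        exact (hc z hz y hyB y' hyB').trans (mul_le_mul_right (edist_le_ediam_of_mem hyV hyV') _)
      have hle : ε ^ t ≤ c z ^ t * ∑ i ∈ J z, ediam (V i) ^ t := by
        refine hsmall.trans ?_
        rw [Finset.mul_sum]
        refine Finset.sum_le_sum fun i _ => ?_
        rw [← ENNReal.mul_rpow_of_nonneg _ _ ht]
        exact ENNReal.rpow_le_rpow (hdiam i) ht
      have h0 : c z ^ t ≠ 0 :=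
        (ENNReal.rpow_pos (pos_iff_ne_zero.2 (hc0 z hz)) (hctop z hz)).ne'
      have htop : c z ^ t ≠ ⊤ := ENNReal.rpow_ne_top_of_nonneg ht (hctop z hz)
      rw [ENNReal.rpow_neg, mul_comm, ← div_eq_mul_inv, ENNReal.div_le_iff h0 htop, mul_comm]
      exact hle
    calc ε ^ t ≤ (∑ z ∈ F, c z ^ (-t)) * ε ^ t := le_mul_of_one_le_left zero_le hsum
      _ = ∑ z ∈ F, c z ^ (-t) * ε ^ t := Finset.sum_mul _ _ _
      _ ≤ ∑ z ∈ F, ∑ i ∈ J z, ediam (V i) ^ t := Finset.sum_le_sum hstep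
      _ = ∑ i ∈ F.biUnion J, ediam (V i) ^ t :=
          (Finset.sum_biUnion fun z hz z' hz' hne => hdisj z hz z' hz' hne).symm
      _ ≤ ∑ i ∈ I, ediam (V i) ^ t := by
          refine Finset.sum_le_sum_of_subset (Finset.biUnion_subset.2 fun z _ => ?_)
          exact Finset.filter_subset _ _

theorem exists_isOpen_ediam_rpow_le {X : Type*} [MetricSpace X] {t : ℝ} (ht : 0 < t) (S : Set X)
    {β : ℝ≥0∞} (hβ : 0 < β) :
    ∃ V, IsOpen V ∧ S ⊆ V ∧ ediam V ^ t ≤ (⨆ _ : S.Nonempty, ediam S ^ t) + β := by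
  rcases S.eq_empty_or_nonempty with rfl | hS
  · exact ⟨∅, isOpen_empty, subset_rfl, by simp [ht]⟩
  simp only [hS, iSup_pos]
  by_cases htop : ediam S ^ t = ⊤
  · exact ⟨univ, isOpen_univ, subset_univ _, by simp [htop]⟩
  have hlim : Tendsto (fun η : ℝ≥0 => (ediam S + 2 * (η : ℝ≥0∞)) ^ t) (𝓝 0)
      (𝓝 (ediam S ^ t)) := by
    have : Continuous fun η : ℝ≥0 => (ediam S + 2 * (η : ℝ≥0∞)) ^ t :=
      ENNReal.continuous_rpow_const.comp (continuous_const.add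
        ((ENNReal.continuous_const_mul (by simp)).comp ENNReal.continuous_coe))
    simpa using this.tendsto 0
  have hlt : ediam S ^ t < ediam S ^ t + β := ENNReal.lt_add_right htop hβ.ne'
  have hev := (hlim.eventually (gt_mem_nhds hlt)).filter_mono
    (nhdsWithin_le_nhds (s := Ioi (0 : ℝ≥0)))
  obtain ⟨η, hη, hη0⟩ := (hev.and self_mem_nhdsWithin).exists
  refine ⟨thickening η S, isOpen_thickening, self_subset_thickening (NNReal.coe_pos.2 hη0) S, ?_⟩
  exact (ENNReal.rpow_le_rpow (ediam_thickening_le η) ht.le).trans hη.le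

open MeasureTheory in
/-- For a compact set, Hausdorff null sets are detected by finite covers. -/
theorem hausdorffMeasure_ne_zero_of_isCompact {X : Type*} [MetricSpace X] [MeasurableSpace X]
    [BorelSpace X] {K : Set X} (hK : IsCompact K) {t : ℝ} (ht : 0 < t) {b : ℝ≥0∞} (hb : 0 < b)
    (h : ∀ (I : Finset ℕ) (V : ℕ → Set X), K ⊆ ⋃ i ∈ I, V i → b ≤ ∑ i ∈ I, ediam (V i) ^ t) :
    Measure.hausdorffMeasure t K ≠ 0 := by
  intro h0
  rw [Measure.hausdorffMeasure_apply] at h0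
  have h1 := le_trans (le_iSup₂ (f := fun (r : ℝ≥0∞) (_ : 0 < r) =>
        ⨅ (t' : ℕ → Set X) (_ : K ⊆ ⋃ n, t' n) (_ : ∀ n, ediam (t' n) ≤ r),
          ∑' n, ⨆ _ : (t' n).Nonempty, ediam (t' n) ^ t) ⊤ ENNReal.zero_lt_top) h0.le
  have hb2 : 0 < b / 2 := ENNReal.half_pos hb.ne'
  obtain ⟨S, hKS, hSlt⟩ : ∃ S : ℕ → Set X, K ⊆ ⋃ n, S n ∧
      ∑' n, (⨆ _ : (S n).Nonempty, ediam (S n) ^ t) < b / 2 := by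
    have := h1.trans_lt hb2
    simp only [iInf_lt_iff] at this
    obtain ⟨S, hS, -, hlt⟩ := this
    exact ⟨S, hS, hlt⟩
  obtain ⟨β, hβ, hβsum⟩ := ENNReal.exists_pos_sum_of_countable' hb2.ne' ℕ
  choose V hVo hSV hV using fun n => exists_isOpen_ediam_rpow_le ht (S n) (hβ n)
  obtain ⟨I, hI⟩ := hK.elim_finite_subcover V hVo (hKS.trans (iUnion_mono hSV))
  refine absurd (h I V hI) (not_le.2 ?_)
  calc ∑ i ∈ I, ediam (V i) ^ t ≤ ∑' i, ediam (V i) ^ t := ENNReal.sum_le_tsum I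
    _ ≤ ∑' i, ((⨆ _ : (S i).Nonempty, ediam (S i) ^ t) + β i) := ENNReal.tsum_le_tsum hV
    _ = ∑' i, (⨆ _ : (S i).Nonempty, ediam (S i) ^ t) + ∑' i, β i := ENNReal.tsum_add
    _ < b / 2 + b / 2 := ENNReal.add_lt_add hSlt hβsum
    _ = b := ENNReal.add_halves b

/-! ### Returning branches and Hausdorff dimension -/

section Dimension

variable {X : Type*} [MetricSpace X] {T : X → X} {X₀ : Set X} {δ C : X → ℝ}
  {𝒜 : X → ℕ → Set (Set X)} {t : ℝ} {n : ℕ}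

theorem exists_ball_lt_branchSum (x : X) {a : X} {c : ℝ≥0∞} (h : c < branchSum T X₀ t n univ a) :
    ∃ ρ, c < branchSum T X₀ t n (ball x ρ) a := by
  obtain ⟨F, hF, hcF⟩ := exists_finset_lt_of_lt_branchSum h
  obtain ⟨ρ, hρ⟩ := F.finite_toSet.isBounded.subset_ball x
  exact ⟨ρ, hcF.trans_le ((sum_branchWeight_le_branchSum fun z hz => (hF hz).1).trans
    (branchSum_mono hρ a))⟩

/-- A uniform lower bound for the Poincaré sums is realised, up to a constant that depends neither
on `n` nor on the bound, by the points of one ball. Near the base point this follows from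
compactness; far from it, the branch condition carries the points over `b₀` in `B(x, ρ₀)` to points
over `b` in `B(x, φ(ρ₀))`, so the inverse branches that matter do not escape to infinity as
`b` does. -/
theorem IsDerivCocycle.exists_ball_le_branchSum [ProperSpace X] (hD : IsDerivCocycle T X₀)
    (ht : 0 ≤ t) (hW : IsWeakWaltersExpanding T X₀ δ 𝒜 C) (hconf : IsMetricConformal T X₀ 𝒜)
    (hbranch : HasComparableBranches T X₀) :
    ∃ (x : X) (q : ℝ≥0∞), q ≠ 0 ∧ q ≠ ⊤ ∧ ∀ n, 1 ≤ n → ∀ c,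
      (∀ b, c < branchSum T X₀ t n univ b) →
        ∃ ρ, ∀ b, c ≤ q * branchSum T X₀ t n (ball x ρ) b := by
  obtain ⟨x, R, K, R₁, φ, -, -, -, hbr⟩ := hbranch
  obtain ⟨E, Q, hQ1, hQ⟩ :=
    hD.exists_distortion_of_isCompact hW hconf (isCompact_closedBall x R)
  have hQt := one_le_ofReal_rpow hQ1 ht
  refine ⟨x, max (ENNReal.ofReal Q ^ t) (ENNReal.ofReal K ^ t),
    (zero_lt_one.trans_le (hQt.trans (le_max_left _ _))).ne',
    (max_lt (ENNReal.rpow_ne_top_of_nonneg ht ENNReal.ofReal_ne_top).lt_top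
      (ENNReal.rpow_ne_top_of_nonneg ht ENNReal.ofReal_ne_top).lt_top).ne, fun n hn c hc => ?_⟩
  have hin : ∃ ρ, ∀ b ∈ closedBall x R,
      c ≤ ENNReal.ofReal Q ^ t * branchSum T X₀ t n (ball x ρ) b := by
    refine (isCompact_closedBall x R).induction_on ⟨0, fun b hb => hb.elim⟩
      (fun s s' hss' ⟨ρ, h⟩ => ⟨ρ, fun b hb => h b (hss' hb)⟩) ?_ ?_
    · rintro s s' ⟨ρ, h⟩ ⟨ρ', h'⟩
      refine ⟨max ρ ρ', fun b hb => ?_⟩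
      rcases hb with hb | hb
      · exact (h b hb).trans (mul_le_mul_right
          (branchSum_mono (ball_subset_ball (le_max_left _ _)) b) _)
      · exact (h' b hb).trans (mul_le_mul_right
          (branchSum_mono (ball_subset_ball (le_max_right _ _)) b) _)
    · intro a ha
      obtain ⟨e, -, hae, hdist⟩ := hQ a ha
      obtain ⟨ρ, hρ⟩ := exists_ball_lt_branchSum x (hc a)
      have hev := hD.eventually_le_branchSum ht isOpen_ball (hW.components e n hn) hae isOpen_ball
        (fun A hA y hy z hz => hdist n hn A hA z hz y hy) hρ
      exact ⟨_, mem_nhdsWithin_of_mem_nhds hev, ρ, fun b hb => hb⟩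
  have hout : ∃ ρ, ∀ b ∉ closedBall x R,
      c ≤ ENNReal.ofReal K ^ t * branchSum T X₀ t n (ball x ρ) b := by
    by_cases h : ∃ b₀, b₀ ∉ closedBall x R
    · obtain ⟨b₀, hb₀⟩ := h
      obtain ⟨ρ, hρ⟩ := exists_ball_lt_branchSum x (hc b₀)
      refine ⟨φ (max ρ R₁), fun b hb => ?_⟩
      obtain ⟨U, 𝒢, -, hb₀U, hbU, hcomp, hdist⟩ :=
        hbr b₀ (fun h => hb₀ (ball_subset_closedBall h)) b
          (fun h => hb (ball_subset_closedBall h)) n hn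
      refine hρ.le.trans ((branchSum_mono (ball_subset_ball (le_max_left ρ R₁)) b₀).trans ?_)
      refine hD.branchSum_le_of_components ht hcomp hb₀U hbU
        fun A hA y hy z hz hyb hzb hyV => ?_
      obtain ⟨-, h₂, h₃⟩ := hdist A hA y hy z hz hyb hzb
      exact ⟨h₂, h₃ _ (le_max_right _ _) hyV⟩
    · push Not at h
      exact ⟨0, fun b hb => (hb (h b)).elim⟩
  obtain ⟨ρ, hρ⟩ := hin
  obtain ⟨ρ', hρ'⟩ := hout
  refine ⟨max ρ ρ', fun b => ?_⟩
  by_cases hb : b ∈ closedBall x R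
  · exact (hρ b hb).trans (mul_le_mul' (le_max_left _ _)
      (branchSum_mono (ball_subset_ball (le_max_left _ _)) b))
  · exact (hρ' b hb).trans (mul_le_mul' (le_max_right _ _)
      (branchSum_mono (ball_subset_ball (le_max_right _ _)) b))

/-- The covering property in quantitative form: over a compact set, the branches that end in a
given ball contribute a definite amount. -/
theorem IsDerivCocycle.exists_pos_le_branchSum_ball (hD : IsDerivCocycle T X₀) (ht : 0 ≤ t)
    (hW : IsWeakWaltersExpanding T X₀ δ 𝒜 C) (hconf : IsMetricConformal T X₀ 𝒜) {a : X}
    (ha : a ∈ X₀) {r : ℝ} (hr : 0 < r) {K : Set X} (hK : IsCompact K) :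
    ∃ (M : ℕ) (β : ℝ≥0∞), 0 < β ∧ ∀ w ∈ K, β ≤ branchSum T X₀ t M (ball a r) w := by
  obtain ⟨M, hM1, hM⟩ := hW.covering a ha r hr K hK
  refine ⟨M, ?_⟩
  refine hK.induction_on ⟨1, one_pos, fun b hb => hb.elim⟩
    (fun s s' hss' ⟨β, hβ, h⟩ => ⟨β, hβ, fun b hb => h b (hss' hb)⟩) ?_ ?_
  · rintro s s' ⟨β, hβ, h⟩ ⟨β', hβ', h'⟩
    refine ⟨min β β', lt_min hβ hβ', fun b hb => ?_⟩
    rcases hb with hb | hb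
    · exact (min_le_left _ _).trans (h b hb)
    · exact (min_le_right _ _).trans (h' b hb)
  · intro w hw
    obtain ⟨z, ⟨hzr, hzM⟩, hzw⟩ := hM hw
    have hz : z ∈ iterPreimage T X₀ M {w} := ⟨hzM, hzw⟩
    obtain ⟨c, hc0, hc⟩ := exists_between
      ((hD.branchWeight_pos hzM).trans_le (branchWeight_le_branchSum (t := t) hz hzr))
    obtain ⟨Q, hQ1, hQ⟩ := hD.exists_distortion hW hconf w
    have hev := hD.eventually_le_branchSum ht isOpen_ball (hW.components w M hM1)
      (mem_ball_self (hW.δ_pos w)) isOpen_ball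
      (fun A hA y hy z hz => hQ M hM1 A hA z hz y hy) hc
    have hqtop : ENNReal.ofReal Q ^ t ≠ ⊤ :=
      ENNReal.rpow_ne_top_of_nonneg ht ENNReal.ofReal_ne_top
    refine ⟨_, mem_nhdsWithin_of_mem_nhds hev, c / ENNReal.ofReal Q ^ t,
      ENNReal.div_pos hc0.ne' hqtop, fun b hb => ?_⟩
    rw [ENNReal.div_le_iff (zero_lt_one.trans_le (one_le_ofReal_rpow hQ1 ht)).ne' hqtop, mul_comm]
    exact hb

/-- If the Poincaré sums tend to infinity, the branches over `a` that return to a given ball around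
`a` already have unbounded sums, along the multiples of a given `N`: all points have many branches
into one ball (`exists_ball_le_branchSum`), these can be composed with themselves arbitrarily often,
and the covering property leads from that ball back to `a`. -/
theorem IsDerivCocycle.exists_lt_branchSum_ball [ProperSpace X] (hD : IsDerivCocycle T X₀)
    (hX₀ : Dense X₀) (ht : 0 ≤ t) (hW : IsWeakWaltersExpanding T X₀ δ 𝒜 C)
    (hconf : IsMetricConformal T X₀ 𝒜) (hbranch : HasComparableBranches T X₀) {a : X}
    (ha : a ∈ X₀) (htop : Tendsto (fun n => branchSum T X₀ t n univ a) atTop (𝓝 ⊤)) {r : ℝ}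
    (hr : 0 < r) {N : ℕ} (hN : 1 ≤ N) {c : ℝ≥0∞} (hc : c ≠ ⊤) (k₀ : ℕ) :
    ∃ k ≥ k₀, c < branchSum T X₀ t (k * N) (ball a r) a := by
  obtain ⟨x, q, hq0, hqtop, hball⟩ := hD.exists_ball_le_branchSum ht hW hconf hbranch
  obtain ⟨M₀, c₀, hc₀, hmix⟩ := hD.exists_mixing hX₀ ht hW hconf hbranch
  have hlim : Tendsto (fun n => c₀ * branchSum T X₀ t n univ a) atTop (𝓝 ⊤) := by
    have := ENNReal.Tendsto.const_mul (a := c₀) htop (Or.inl ENNReal.top_ne_zero)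
    rwa [ENNReal.mul_top hc₀.ne'] at this
  obtain ⟨n₀, hn₀⟩ := eventually_atTop.1 (hlim.eventually
    (lt_mem_nhds (ENNReal.mul_lt_top hqtop.lt_top (by simp : (2 : ℝ≥0∞) < ⊤))))
  set n' := n₀ + M₀ + 1 with hn'
  have hn'N : n' ≤ n' * N := Nat.le_mul_of_pos_right _ hN
  obtain ⟨ρ, hρ⟩ := hball (n' * N) (by omega) (q * 2) fun b => by
    have := (hn₀ (n' * N - M₀) (by omega)).trans_le (hmix _ a b)
    rwa [Nat.sub_add_cancel (by omega)] at this
  have htwo : ∀ b, 2 ≤ branchSum T X₀ t (n' * N) (ball x ρ) b := fun b =>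
    (ENNReal.mul_le_mul_iff_right hq0 hqtop).1 (hρ b)
  obtain ⟨M, β, hβ, hMβ⟩ := hD.exists_pos_le_branchSum_ball (t := t) ht hW hconf ha hr
    (isCompact_closedBall x ρ)
  -- `j` extra steps make the total number of steps a multiple of `N`.
  set j := M * N - M with hj
  have hMN : M ≤ M * N := Nat.le_mul_of_pos_right _ hN
  have hlow : ∀ k, β * (2 ^ (k + 1) * branchSum T X₀ t j univ a) ≤
      branchSum T X₀ t ((M + (k + 1) * n') * N) (ball a r) a := by
    intro k
    have h := hD.mul_branchSum_le_branchSum_add (m := j + (k + 1) * (n' * N)) (Y := ball x ρ)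
      (fun w hw => hMβ w (ball_subset_closedBall hw)) a
    have htime : j + (k + 1) * (n' * N) + M = (M + (k + 1) * n') * N := by
      rw [add_mul M, mul_assoc]
      generalize (k + 1) * (n' * N) = l
      omega
    rw [htime] at h
    exact (mul_le_mul_right (hD.pow_le_branchSum htwo k j a) _).trans h
  have hlim2 : Tendsto (fun k : ℕ => β * (2 ^ (k + 1) * branchSum T X₀ t j univ a)) atTop
      (𝓝 ⊤) := by
    have hpow : Tendsto (fun k : ℕ => (2 : ℝ≥0∞) ^ (k + 1)) atTop (𝓝 ⊤) :=
      (ENNReal.tendsto_pow_atTop_nhds_top_iff.2 (by norm_num)).comp (tendsto_add_atTop_nat 1)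
    have h₁ := ENNReal.Tendsto.mul_const (b := branchSum T X₀ t j univ a) hpow
      (Or.inl ENNReal.top_ne_zero)
    rw [ENNReal.top_mul (hD.branchSum_pos hX₀ hW j a).ne'] at h₁
    have h₂ := ENNReal.Tendsto.const_mul (a := β) h₁ (Or.inl ENNReal.top_ne_zero)
    rwa [ENNReal.mul_top hβ.ne'] at h₂
  obtain ⟨k, hk, hkk₀⟩ := ((hlim2.eventually (lt_mem_nhds hc.lt_top)).and
    (eventually_ge_atTop k₀)).exists
  refine ⟨M + (k + 1) * n', ?_, hk.trans_le (hlow k)⟩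
  have : k + 1 ≤ (k + 1) * n' := Nat.le_mul_of_pos_right _ (by omega)
  omega

theorem IsInjectiveComponents.isCompact_inter_preimage {U : Set X} {𝒢 : Set (Set X)}
    (h : IsInjectiveComponents T X₀ n U 𝒢) {A : Set X} (hA : A ∈ 𝒢) {K : Set X}
    (hK : IsCompact K) (hKU : K ⊆ U) : IsCompact (A ∩ T^[n] ⁻¹' K) := by
  obtain ⟨e, he⟩ := h.homeo A hA
  have hset : A ∩ T^[n] ⁻¹' K = Subtype.val '' (e.symm '' (Subtype.val ⁻¹' K)) := by
    ext y
    constructor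
    · rintro ⟨hy, hyK⟩
      refine ⟨⟨y, hy⟩, ⟨e ⟨y, hy⟩, ?_, e.symm_apply_apply _⟩, rfl⟩
      rw [mem_preimage, he]
      exact hyK
    · rintro ⟨_, ⟨u, hu, rfl⟩, rfl⟩
      refine ⟨(e.symm u).2, ?_⟩
      rw [mem_preimage, ← he, e.apply_symm_apply]
      exact hu
  rw [hset]
  have hcomp : IsCompact (Subtype.val ⁻¹' K : Set U) :=
    IsInducing.subtypeVal.isCompact_preimage' hK (by simpa using hKU)
  exact (hcomp.image e.symm.continuous).image continuous_subtype_val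

theorem exists_pos_le_edist_of_isCompact {F : Finset X} {B : X → Set X}
    (hB : ∀ z ∈ F, IsCompact (B z)) (hdisj : ∀ z ∈ F, ∀ z' ∈ F, z ≠ z' → Disjoint (B z) (B z')) :
    ∃ ε : ℝ≥0∞, 0 < ε ∧ ε ≠ ⊤ ∧ ∀ z ∈ F, ∀ z' ∈ F, z ≠ z' → ∀ y ∈ B z, ∀ y' ∈ B z',
      ε ≤ edist y y' := by
  classical
  have hex : ∀ p ∈ F.offDiag, ∃ s : ℝ≥0∞, 0 < s ∧ ∀ y ∈ B p.1, ∀ y' ∈ B p.2, s ≤ edist y y' := by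
    intro p hp
    obtain ⟨h₁, h₂, hne⟩ := Finset.mem_offDiag.1 hp
    obtain ⟨s, hs, h⟩ := exists_pos_forall_lt_edist (hB _ h₁) (hB _ h₂).isClosed
      (hdisj _ h₁ _ h₂ hne)
    exact ⟨s, ENNReal.coe_pos.2 hs, fun y hy y' hy' => (h y hy y' hy').le⟩
  choose! s hs hsB using hex
  refine ⟨min 1 (F.offDiag.inf s), lt_min one_pos ((Finset.lt_inf_iff ENNReal.zero_lt_top).2 hs),
    (min_lt_of_left_lt ENNReal.one_lt_top).ne, fun z hz z' hz' hne y hy y' hy' => ?_⟩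
  have hp : (z, z') ∈ F.offDiag := Finset.mem_offDiag.2 ⟨hz, hz', hne⟩
  exact (min_le_right _ _).trans ((Finset.inf_le hp).trans (hsB _ hp y hy y' hy'))

open MeasureTheory in
/-- If the Poincaré sums with exponent `t` tend to infinity, finitely many inverse branches map a
compact ball around `a` into itself, disjointly, and with `∑ (Lipschitz constant of Tⁿ)^{-t} ≥ 1`.
The ball then has positive `t`-dimensional Hausdorff measure. -/
theorem IsDerivCocycle.hausdorffMeasure_univ_ne_zero [ProperSpace X] [MeasurableSpace X]
    [BorelSpace X] (hD : IsDerivCocycle T X₀) (hX₀ : Dense X₀) (ht : 0 < t)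
    (hW : IsWeakWaltersExpanding T X₀ δ 𝒜 C) (hconf : IsMetricConformal T X₀ 𝒜)
    (hbranch : HasComparableBranches T X₀) {a : X} (ha : a ∈ X₀) (hC : 1 < C a)
    (htop : Tendsto (fun n => branchSum T X₀ t n univ a) atTop (𝓝 ⊤)) :
    Measure.hausdorffMeasure t (univ : Set X) ≠ 0 := by
  obtain ⟨ϱ, hϱ, N, hN, hexp⟩ := hW.expanding a
  obtain ⟨Q, hQ1, hQ⟩ := hD.exists_distortion hW hconf a
  have hQ0 : 0 < Q := one_pos.trans_le hQ1
  set r := δ a / 2 with hr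
  have hδ := hW.δ_pos a
  have hr0 : 0 < r := half_pos hδ
  have hrδ : r < δ a := half_lt_self hδ
  have hgrow : Tendsto (fun k : ℕ => ϱ * C a ^ k) atTop atTop :=
    (tendsto_pow_atTop_atTop_of_one_lt hC).const_mul_atTop hϱ
  obtain ⟨k₀, hk₀⟩ := eventually_atTop.1 (hgrow.eventually_ge_atTop 2)
  have hQttop : ENNReal.ofReal Q ^ t ≠ ⊤ :=
    ENNReal.rpow_ne_top_of_nonneg ht.le ENNReal.ofReal_ne_top
  have hQt1 := one_le_ofReal_rpow hQ1 ht.le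
  obtain ⟨k, hkk₀, hk⟩ := hD.exists_lt_branchSum_ball hX₀ ht.le hW hconf hbranch ha htop
    (half_pos hr0) hN hQttop (k₀ + 1)
  have hk1 : 1 ≤ k := by omega
  have hk2 : 2 ≤ ϱ * C a ^ k := hk₀ k (by omega)
  set m := k * N with hm
  have hm1 : 1 ≤ m := Nat.mul_pos hk1 hN
  have hcomp := hW.components a m hm1
  have haball := mem_ball_self (x := a) hδ
  obtain ⟨F, hF, hcF⟩ := exists_finset_lt_of_lt_branchSum hk
  choose! A hA hzA using fun z (hz : z ∈ F) => hcomp.exists_mem haball (hF hz).1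
  have hderiv : ∀ z ∈ F, 2 ≤ metricDeriv T^[m] z := fun z hz =>
    hk2.trans (hD.le_metricDeriv hcomp (hA z hz) (hexp k hk1 _ (hA z hz)) (hzA z hz))
  have hF1 : 1 < F.card := by
    by_contra hcard
    have hw : ∀ z ∈ F, branchWeight T t m z ≤ 1 := by
      intro z hz
      rw [branchWeight, ENNReal.rpow_neg, ENNReal.inv_le_one]
      exact one_le_ofReal_rpow (one_le_two.trans (hderiv z hz)) ht.le
    have hsum := Finset.sum_le_card_nsmul F _ 1 hw
    have hcard1 : (F.card : ℝ≥0∞) ≤ 1 := by exact_mod_cast not_lt.1 hcard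
    rw [nsmul_one] at hsum
    exact absurd (hcF.trans_le (hsum.trans (hcard1.trans hQt1))) (lt_irrefl _)
  have hKball : closedBall a r ⊆ ball a (δ a) := closedBall_subset_ball hrδ
  set B : X → Set X := fun z => A z ∩ T^[m] ⁻¹' closedBall a r with hB
  have hdisj : ∀ z ∈ F, ∀ z' ∈ F, z ≠ z' → Disjoint (B z) (B z') := by
    intro z hz z' hz' hne
    have hAne : A z ≠ A z' := by
      intro hAA
      refine hne (hcomp.injOn (hA z hz) (hzA z hz) (hAA ▸ hzA z' hz') ?_)
      exact ((hF hz).1.2 : T^[m] z = a).trans ((hF hz').1.2 : T^[m] z' = a).symm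
    exact (hcomp.disjoint (hA z hz) (hA z' hz') hAne).mono inter_subset_left inter_subset_left
  obtain ⟨ε, hε0, hεtop, hε⟩ := exists_pos_le_edist_of_isCompact
    (fun z hz => hcomp.isCompact_inter_preimage (hA z hz) (isCompact_closedBall a r) hKball) hdisj
  have hBK : ∀ z ∈ F, B z ⊆ closedBall a r := by
    rintro z hz y ⟨hyA, hyK⟩
    have h₁ := hexp k hk1 _ (hA z hz) y hyA z (hzA z hz)
    rw [show T^[k * N] z = a from (hF hz).1.2] at h₁
    have h₂ : dist (T^[k * N] y) a ≤ r := hyK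
    have h₃ : dist z a < r / 2 := (hF hz).2
    have h₄ : 2 * dist y z ≤ ϱ * C a ^ k * dist y z := mul_le_mul_of_nonneg_right hk2 dist_nonneg
    rw [mem_closedBall]
    linarith [dist_triangle y z a]
  have hmeas : Measure.hausdorffMeasure t (closedBall a r) ≠ 0 := by
    refine hausdorffMeasure_ne_zero_of_isCompact (isCompact_closedBall a r) ht
      (b := ε ^ t) (ENNReal.rpow_pos hε0 hεtop) fun I V hV => ?_
    refine rpow_le_sum_ediam_rpow (nonempty_closedBall.2 hr0.le) hF1 (f := T^[m])
      (c := fun z => ENNReal.ofReal (Q * metricDeriv T^[m] z)) ht.le hBK ?_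
      hε ?_ ?_ (fun z _ => ENNReal.ofReal_ne_top) ?_ I V hV
    · intro z hz b hb
      obtain ⟨y, hy, hyb⟩ := hcomp.surjOn (hA z hz) (hKball hb)
      exact ⟨y, ⟨hy, by rw [mem_preimage, hyb]; exact hb⟩, hyb⟩
    · intro z hz y hy y' hy'
      obtain ⟨w, hw, hle⟩ := hconf.mean_value a m hm1 _ (hA z hz) y hy.1 y' hy'.1
      rw [edist_dist, edist_dist, ← ENNReal.ofReal_mul' dist_nonneg]
      exact ENNReal.ofReal_le_ofReal (hle.trans (mul_le_mul_of_nonneg_right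
        (hQ m hm1 _ (hA z hz) w hw z (hzA z hz)) dist_nonneg))
    · intro z hz
      exact (ENNReal.ofReal_pos.2 (mul_pos hQ0 (two_pos.trans_le (hderiv z hz)))).ne'
    · have hterm : ∀ z ∈ F, ENNReal.ofReal (Q * metricDeriv T^[m] z) ^ (-t) =
          (ENNReal.ofReal Q ^ t)⁻¹ * branchWeight T t m z := by
        intro z _
        rw [ENNReal.ofReal_mul hQ0.le,
          ENNReal.mul_rpow_of_ne_top ENNReal.ofReal_ne_top ENNReal.ofReal_ne_top,
          ENNReal.rpow_neg (ENNReal.ofReal Q), branchWeight]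
      rw [Finset.sum_congr rfl hterm, ← Finset.mul_sum, mul_comm, ← div_eq_mul_inv,
        ENNReal.le_div_iff_mul_le (Or.inl (zero_lt_one.trans_le hQt1).ne') (Or.inl hQttop),
        one_mul]
      exact hcF.le
  exact fun h0 => hmeas (measure_mono_null (subset_univ _) h0)

end Dimension

/-! ### Pressure and the Poincaré exponent -/

section Pressure

variable {X : Type*} [MetricSpace X] {T : X → X} {X₀ : Set X} {δ C : X → ℝ}
  {𝒜 : X → ℕ → Set (Set X)} {t : ℝ}

theorem hasPressure_of_tendsto {p : EReal}
    (h : ∀ a, Tendsto (fun n : ℕ => ENNReal.log (branchSum T X₀ t n univ a) / (n : EReal)) atTop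
      (𝓝 p)) : HasPressure T X₀ t p := by
  intro a
  have ha : Tendsto (fun n : ℕ => ENNReal.log (poincareSum T X₀ t n a) / (n : EReal)) atTop
      (𝓝 p) := by
    simpa only [poincareSum_eq_branchSum] using h a
  exact ⟨ha.limsup_eq, ha.liminf_eq⟩

theorem HasPressure.eq [Nonempty X] {p p' : EReal} (h : HasPressure T X₀ t p)
    (h' : HasPressure T X₀ t p') : p = p' := by
  obtain ⟨a⟩ := ‹Nonempty X›
  rw [← (h a).1, (h' a).1]

/-- Positive pressure at an exponent `t` above the Hausdorff dimension would give `X` positive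
`t`-dimensional Hausdorff measure. -/
theorem IsDerivCocycle.pressure_nonpos [ProperSpace X] [Nonempty X] (hD : IsDerivCocycle T X₀)
    (hX₀ : Dense X₀) (hW : IsWeakWaltersExpanding T X₀ δ 𝒜 C) (hconf : IsMetricConformal T X₀ 𝒜)
    (hC : ∀ a, 1 < C a) (hbranch : HasComparableBranches T X₀) {s : ℝ≥0}
    (hs : dimH (univ : Set X) < s) {p : EReal}
    (hp : ∀ a, Tendsto (fun n : ℕ => ENNReal.log (branchSum T X₀ s n univ a) / (n : EReal)) atTop
      (𝓝 p)) : p ≤ 0 := by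
  by_contra hp0
  obtain ⟨a, ha⟩ := hX₀.nonempty
  borelize X
  have hs0 : (0 : ℝ) < s := by
    have : (0 : ℝ≥0∞) < s := zero_le.trans_lt hs
    exact_mod_cast this
  exact hD.hausdorffMeasure_univ_ne_zero hX₀ hs0 hW hconf hbranch ha (hC a)
    (tendsto_top_of_tendsto_log_div (hp a) (not_le.1 hp0)) (hausdorffMeasure_of_dimH_lt hs)

end Pressure

theorem mainTheorem12 {X : Type*} [MetricSpace X] [ProperSpace X]
    (X₀ : Set X) (hX₀_open : IsOpen X₀) (hX₀_dense : Dense X₀)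
    (T : X → X) (hT : ContinuousOn T X₀)
    (δ : X → ℝ) (𝒜 : X → ℕ → Set (Set X)) (C : X → ℝ)
    (hW : IsWeakWaltersExpanding T X₀ δ 𝒜 C)
    (hconf : IsMetricConformal T X₀ 𝒜)
    (hC : ∀ a, 1 < C a)
    (hbranch : HasComparableBranches T X₀)
    (hdim : dimH (Set.univ : Set X) < ⊤) :
    (∀ t : ℝ≥0, ∃ p : EReal, HasPressure T X₀ (t : ℝ) p) ∧
    (poincareExponent T X₀ ≤ dimH (Set.univ : Set X) ∧ dimH (Set.univ : Set X) < ⊤) ∧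
    (∀ t : ℝ≥0, (t : ℝ≥0∞) < poincareExponent T X₀ → ∀ a : X,
      Tendsto (fun n : ℕ => poincareSum T X₀ (t : ℝ) n a) atTop (𝓝 ⊤)) ∧
    (∀ t : ℝ≥0, poincareExponent T X₀ < (t : ℝ≥0∞) → ∀ a : X,
      Tendsto (fun n : ℕ => poincareSum T X₀ (t : ℝ) n a) atTop (𝓝 0)) := by
  have : Nonempty X := ⟨hbranch.choose⟩
  have hD := isDerivCocycle hX₀_dense hW hconf
  choose P hP using fun t : ℝ≥0 => hD.exists_pressure hX₀_dense t.2 hW hconf hbranch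
  have hasP : ∀ t : ℝ≥0, HasPressure T X₀ (t : ℝ) (P t) := fun t => hasPressure_of_tendsto (hP t)
  simp only [poincareSum_eq_branchSum]
  refine ⟨fun t => ⟨P t, hasP t⟩, ⟨?_, hdim⟩, fun t ht a => ?_, fun t ht a => ?_⟩
  · by_contra hlt
    obtain ⟨s, hs, hsT⟩ := ENNReal.lt_iff_exists_nnreal_btwn.1 (not_le.1 hlt)
    exact absurd hsT (not_lt.2 (iInf₂_le s ⟨P s, hasP s,
      hD.pressure_nonpos hX₀_dense hW hconf hC hbranch hs (hP s)⟩))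
  · refine tendsto_top_of_tendsto_log_div (hP t a) (not_le.1 fun hp => ?_)
    exact absurd ht (not_lt.2 (iInf₂_le t ⟨P t, hasP t, hp⟩))
  · simp only [poincareExponent, iInf_lt_iff] at ht
    obtain ⟨t', ⟨p, hp, hp0⟩, htt'⟩ := ht
    rw [hp.eq (hasP t')] at hp0
    exact tendsto_zero_of_tendsto_log_div (hP t a)
      (hD.pressure_neg hW (hC a) (by exact_mod_cast htt') (hP t a) (hP t' a) hp0)
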